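/- **Setting.** Addresses are finite words of natural numbers; $\xi i$ is $\xi$ followed by the letter $i$, $\xi\star J=\{\xi j\mid j\in J\}$, and two addresses are disjoint if neither is a prefix of the other. A base is $\vdash\Lambda$ or $\zeta\vdash\Lambda$ with $\Lambda$ a finite set of addresses; it is well formed if its addresses are pairwise disjoint. Positive and negative pseudo-designs are the (possibly infinitely wide and infinitely deep) trees generated by $$\phi::=\Omega\mid\maltese\mid(+,\xi,I)\cdot\{\psi_{\xi i}\mid i\in I\},\qquad \psi_\zeta::=\{(-,\zeta,J)\,\phi_J\mid J\in\mathcal P_f(\omega)\},$$ with $I\subseteq\omega$ finite; write $\psi_{\zeta,J}$ for $\phi_J$. They are typed by the following rules, read coinductively (bases are always well formed): $\Omega:(\vdash\Lambda)$; $\maltese:(\vdash\Lambda)$; $(+,\xi,I)\cdot\{\psi_{\xi i}\mid i\in I\}:(\vdash\xi,\Lambda)$ if $\psi_{\xi i}:(\xi i\vdash\Lambda_i)$ for all $i\in I$ with pairwise disjoint sets $\Lambda_i\subseteq\Lambda$; and $\{(-,\zeta,J)\phi_J\mid J\}:(\zeta\vdash\Lambda)$ if for every $J$ there is $\Lambda_J\subseteq\Lambda$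 with $\phi_J:(\vdash\zeta\star J,\Lambda_J)$. For a positive $\phi$ and a finite set $\Psi$ of negative pseudo-designs with pairwise disjoint foci, $\Psi$ accepts $\xi$ if it has an element $\Psi_\xi$ with focus $\xi$; then $\Psi\setminus\xi=\Psi\setminus\{\Psi_\xi\}$. The normal form $⟦\phi,\Psi⟧$ is the positive pseudo-design obtained as follows. Apply to the state $\langle\phi\mid\Psi\rangle$, as long as possible, the rule $$\langle(+,\xi,I)\cdot\Psi'\mid\Psi\rangle\longrightarrow\langle\Psi_{\xi,I}\mid\Psi'\cup(\Psi\setminus\xi)\rangle\qquad(\Psi\text{ accepts }\xi).$$ If this does not terminate, or stops on $\Omega$, the normal form is $\Omega$; if it stops on $\maltese$, it is $\maltese$; if it stops on $\langle(+,\xi,I)\cdot\Psi'\mid\Psi''\rangle$ with $\xi$ not accepted by $\Psi''$, its root is $(+,\xi,I)$ and, for all $i\in I$ and $J\in\mathcal P_f(\omega)$, the subtree above $(-,\xi i,J)$ is $⟦\Psi'_{\xi i,J},\Psi''⟧$. A positive $\phi:(\vdash\Lambda_0)$ and a finite set $\Psi$ of negative $\psi:(\zeta_\psi\vdash\Lambda_\psi)$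 form a net (with these bases) if (1) any two addresses occurring in the bases are disjoint or equal; (2) an address occurs at most twice in these bases; (3) if it occurs twice, it occurs once on the left and once on the right of $\vdash$, and is then called a cut; (4) the multigraph with vertices $\{\phi\}\cup\Psi$ and the cuts as edges is acyclic. **Theorem (Associativity).** Let $\phi$ and $\Psi_1\cup\Psi_2$ form a net, and suppose that no left address $\zeta_\psi$ of an element $\psi\in\Psi_1$ occurs on the right of the base of an element of $\Psi_2\setminus\Psi_1$ (this holds in particular when the cut graph of $\phi$ and $\Psi_1$ alone is connected). Then $$⟦⟦\phi,\Psi_1⟧,\Psi_2⟧=⟦\phi,\Psi_1\cup\Psi_2⟧.$$ -/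

import Mathlib

noncomputable section

namespace Ludics

/-! ### Addresses and bases -/

/-- Addresses are words of natural numbers. -/
abbrev Address := List ℕ

/-- The address `ξ i`. -/
def Address.ext (ξ : Address) (i : ℕ) : Address := ξ ++ [i]

/-- `ξ ⋆ J = {ξ j | j ∈ J}`. -/
def Address.star (ξ : Address) (J : Finset ℕ) : Finset Address := J.image (Address.ext ξ)

/-- Two addresses are disjoint when neither is a prefix of the other. -/
def Address.Disj (a b : Address) : Prop := ¬ a <+: b ∧ ¬ b <+: a

/-- The positive base `⊢ Λ` is well formed. -/
def WFPos (Λ : Finset Address) : Prop :=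
  ∀ a ∈ Λ, ∀ b ∈ Λ, a ≠ b → Address.Disj a b

/-- The negative base `ζ ⊢ Λ` is well formed. -/
def WFNeg (ζ : Address) (Λ : Finset Address) : Prop :=
  WFPos Λ ∧ ∀ a ∈ Λ, Address.Disj ζ a

/-! ### Pseudo-designs

Pseudo-designs are possibly infinite trees, both in width and in depth:
  `φ ::= Ω | ✠ | (+, ξ, I) · {ψ_{ξ i} | i ∈ I}`,
  `ψ_ζ ::= {(-, ζ, J) φ_J | J a finite set of naturals}`.
They form the final coalgebra of the functor below: the node `(+, ξ, I)` has one positive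
subtree for each pair `(i, J)` with `i ∈ I` and `J` finite, namely what follows the negative
action `(-, ξ i, J)`. -/

/-- Labels of the nodes: `Ω`, `✠`, or a positive action `(+, ξ, I)`. -/
inductive PosAction : Type
  | omega : PosAction
  | daimon : PosAction
  | proper (ξ : Address) (I : Finset ℕ) : PosAction

/-- Index type of the positive subtrees above a label. -/
abbrev PosAction.Arity : PosAction → Type
  | .omega => Empty
  | .daimon => Empty
  | .proper _ I => {i // i ∈ I} × Finset ℕ

/-- The functor whose final coalgebra is the type of positive pseudo-designs. -/
abbrev designFunctor : PFunctor.{0, 0} := ⟨PosAction, PosAction.Arity⟩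

/-- Positive pseudo-designs. -/
abbrev PosDesign : Type := PFunctor.M designFunctor

/-- Negative pseudo-designs `ψ_ζ = {(-, ζ, J) φ_J | J}`, with `focus = ζ` and `body J = φ_J`. -/
structure NegDesign : Type where
  focus : Address
  body : Finset ℕ → PosDesign

/-- One layer `Ω`. -/
def omegaLayer (X : Type) : designFunctor.Obj X := ⟨PosAction.omega, fun e => Empty.elim e⟩

/-- One layer `✠`. -/
def daimonLayer (X : Type) : designFunctor.Obj X := ⟨PosAction.daimon, fun e => Empty.elim e⟩

/-- One layer `(+, ξ, I)`, with what stands above each `(-, ξ i, J)`. -/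
def nodeLayer {X : Type} (ξ : Address) (I : Finset ℕ) (c : {i // i ∈ I} → Finset ℕ → X) :
    designFunctor.Obj X :=
  ⟨PosAction.proper ξ I, fun p => c p.1 p.2⟩

/-- The pseudo-design `Ω`. -/
def PosDesign.omega : PosDesign := PFunctor.M.mk (omegaLayer PosDesign)

/-- The pseudo-design `✠`. -/
def PosDesign.daimon : PosDesign := PFunctor.M.mk (daimonLayer PosDesign)

/-- The pseudo-design `(+, ξ, I) · {ψ_{ξ i} | i ∈ I}` with `ψ_{ξ i} = {(-, ξ i, J) (c i J) | J}`. -/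
def PosDesign.node (ξ : Address) (I : Finset ℕ) (c : {i // i ∈ I} → Finset ℕ → PosDesign) :
    PosDesign :=
  PFunctor.M.mk (nodeLayer ξ I c)

/-- The set `{ψ_{ξ i} | i ∈ I}` of negative pseudo-designs above the root of `node ξ I c`. -/
def negChildren (ξ : Address) (I : Finset ℕ) (c : {i // i ∈ I} → Finset ℕ → PosDesign) :
    Set NegDesign :=
  Set.range fun i : {i // i ∈ I} => NegDesign.mk (Address.ext ξ i) (c i)

/-! ### Typing

Since designs may have infinite depth, the typing rules are read coinductively: a pseudo-design
has a type when some relation containing the pair is closed under backward application of the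
rules. -/

/-- The rule with conclusion `ψ : (ζ ⊢ Λ)`, where `R` gives the judgements on positive premises. -/
def NegRule (R : PosDesign → Finset Address → Prop) (ψ : NegDesign) (Λ : Finset Address) : Prop :=
  WFNeg ψ.focus Λ ∧
    ∀ J : Finset ℕ, ∃ ΛJ : Finset Address, ΛJ ⊆ Λ ∧ R (ψ.body J) (Address.star ψ.focus J ∪ ΛJ)

/-- The rules with conclusion `φ : (⊢ Λ)`, where `R` gives the judgements on positive premises
(two layers up, through the negative rule). -/
inductive PosRule (R : PosDesign → Finset Address → Prop) : PosDesign → Finset Address → Prop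
  | omega {Λ : Finset Address} (hwf : WFPos Λ) : PosRule R PosDesign.omega Λ
  | daimon {Λ : Finset Address} (hwf : WFPos Λ) : PosRule R PosDesign.daimon Λ
  | node {ξ : Address} {I : Finset ℕ} {c : {i // i ∈ I} → Finset ℕ → PosDesign}
      {Λ : Finset Address} (Λi : {i // i ∈ I} → Finset Address)
      (hsub : ∀ i, Λi i ⊆ Λ)
      (hdisj : ∀ i j, i ≠ j → Disjoint (Λi i) (Λi j))
      (hξ : ξ ∉ Λ) (hwf : WFPos (insert ξ Λ))
      (hneg : ∀ i : {i // i ∈ I}, NegRule R ⟨Address.ext ξ i, c i⟩ (Λi i)) :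
      PosRule R (PosDesign.node ξ I c) (insert ξ Λ)

/-- `φ : (⊢ Λ)`. -/
def HasPosType (φ : PosDesign) (Λ : Finset Address) : Prop :=
  ∃ R : PosDesign → Finset Address → Prop,
    (∀ φ' Λ', R φ' Λ' → PosRule R φ' Λ') ∧ R φ Λ

/-- `ψ : (ζ ⊢ Λ)`, where `ζ` is the focus of `ψ`. -/
def HasNegType (ψ : NegDesign) (Λ : Finset Address) : Prop := NegRule HasPosType ψ Λ

/-! ### Normalization -/

/-- States of the machine: a positive pseudo-design against a set of negative ones. -/
abbrev State : Type := PosDesign × Set NegDesign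

/-- `Ψ` accepts `ξ`. -/
def Accepts (Ψ : Set NegDesign) (ξ : Address) : Prop := ∃ ψ ∈ Ψ, ψ.focus = ξ

/-- `Ψ \ ξ`. -/
def remove (Ψ : Set NegDesign) (ξ : Address) : Set NegDesign := {ψ ∈ Ψ | ψ.focus ≠ ξ}

/-- The weak reduction rule (R):
`⟨(+, ξ, I) · Ψ' | Ψ⟩ ⟶ ⟨Ψ_{ξ, I} | Ψ' ∪ (Ψ \ ξ)⟩` when `Ψ` accepts `ξ`. -/
inductive Step : State → State → Prop
  | cut {ξ : Address} {I : Finset ℕ} {c : {i // i ∈ I} → Finset ℕ → PosDesign}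
      {Ψ : Set NegDesign} {ψ : NegDesign} (hψ : ψ ∈ Ψ) (hξ : ψ.focus = ξ) :
      Step (PosDesign.node ξ I c, Ψ) (ψ.body I, negChildren ξ I c ∪ remove Ψ ξ)

/-- Observations on a state on which rule (R) stops: `Ω`, `✠`, or a root `(+, ξ, I)` whose focus
is not accepted. In the last case the strong reduction rule (S) relaunches the machine, for each
`i ∈ I` and `J`, on the state `⟨Ψ'_{ξ i, J} | Ψ⟩`. -/
inductive Final : State → designFunctor.Obj State → Prop
  | omega {Ψ : Set NegDesign} : Final (PosDesign.omega, Ψ) (omegaLayer State)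
  | daimon {Ψ : Set NegDesign} : Final (PosDesign.daimon, Ψ) (daimonLayer State)
  | head {ξ : Address} {I : Finset ℕ} {c : {i // i ∈ I} → Finset ℕ → PosDesign}
      {Ψ : Set NegDesign} (hξ : ¬ Accepts Ψ ξ) :
      Final (PosDesign.node ξ I c, Ψ) (nodeLayer ξ I fun i J => (c i J, Ψ))

/-- The observation `o` is output by the weak machine started on `s`. -/
def Outputs (s : State) (o : designFunctor.Obj State) : Prop :=
  ∃ t, Relation.ReflTransGen Step s t ∧ Final t o

open Classical in
/-- The first layer of the normal form of a state; it is `Ω` when the weak machine does not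
terminate. On the states arising from nets the machine is deterministic, so that
there is at most one output to choose. -/
def observe (s : State) : designFunctor.Obj State :=
  if h : ∃ o, Outputs s o then h.choose else omegaLayer State

/-- The normal form `⟦φ, Ψ⟧`, built layer by layer by strong reduction. -/
def normalForm (φ : PosDesign) (Ψ : Set NegDesign) : PosDesign :=
  PFunctor.M.corec observe (φ, Ψ)

/-! ### Nets -/

/-- Vertices of a net: the principal design `φ` (`none`) and the elements of `Ψ`. -/
def vertices (Ψ : Set NegDesign) : Set (Option NegDesign) := insert none (some '' Ψ)

/-- The addresses on the left of `⊢` in the base of a vertex. -/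
def leftOf : Option NegDesign → Set Address
  | none => ∅
  | some ψ => {ψ.focus}

/-- The addresses on the right of `⊢` in the base of a vertex. -/
def rightOf (Λ₀ : Finset Address) (Λ : NegDesign → Finset Address) :
    Option NegDesign → Set Address
  | none => Λ₀
  | some ψ => Λ ψ

/-- The address `a` forms a cut between the vertices `u` and `v`. -/
def Cut (Λ₀ : Finset Address) (Λ : NegDesign → Finset Address) (a : Address)
    (u v : Option NegDesign) : Prop :=
  (a ∈ rightOf Λ₀ Λ u ∧ a ∈ leftOf v) ∨ (a ∈ rightOf Λ₀ Λ v ∧ a ∈ leftOf u)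

/-- The simple graph underlying the multigraph of cuts. -/
def cutGraph (Λ₀ : Finset Address) (Ψ : Set NegDesign) (Λ : NegDesign → Finset Address) :
    SimpleGraph (Option NegDesign) where
  Adj u v := u ≠ v ∧ u ∈ vertices Ψ ∧ v ∈ vertices Ψ ∧ ∃ a, Cut Λ₀ Λ a u v
  symm := ⟨by
    rintro u v ⟨hne, hu, hv, a, ha⟩
    exact ⟨hne.symm, hv, hu, a, ha.symm⟩⟩
  loopless := ⟨fun _ h => h.1 rfl⟩

/-- `φ` and the finite set `Ψ` form a net, with bases `⊢ Λ₀` for `φ` and `ψ.focus ⊢ Λ ψ` for the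
elements `ψ` of `Ψ`. -/
structure IsNet (φ : PosDesign) (Λ₀ : Finset Address) (Ψ : Set NegDesign)
    (Λ : NegDesign → Finset Address) : Prop where
  finite : Ψ.Finite
  typed_pos : HasPosType φ Λ₀
  typed_neg : ∀ ψ ∈ Ψ, HasNegType ψ (Λ ψ)
  /-- The addresses of the bases are pairwise disjoint or equal. -/
  disj_or_eq : ∀ u ∈ vertices Ψ, ∀ v ∈ vertices Ψ,
    ∀ a ∈ leftOf u ∪ rightOf Λ₀ Λ u, ∀ b ∈ leftOf v ∪ rightOf Λ₀ Λ v,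
      a = b ∨ Address.Disj a b
  /-- With `right_unique`: an address appears at most twice, and if it appears twice then
  it appears once on the left and once on the right of `⊢`. -/
  left_unique : ∀ u ∈ vertices Ψ, ∀ v ∈ vertices Ψ, ∀ a, a ∈ leftOf u → a ∈ leftOf v → u = v
  right_unique : ∀ u ∈ vertices Ψ, ∀ v ∈ vertices Ψ,
    ∀ a, a ∈ rightOf Λ₀ Λ u → a ∈ rightOf Λ₀ Λ v → u = v
  /-- With `acyclic`: the multigraph of cuts is acyclic. Here, no double edge. -/
  no_double_edge : ∀ u ∈ vertices Ψ, ∀ v ∈ vertices Ψ,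
    ∀ a b, Cut Λ₀ Λ a u v → Cut Λ₀ Λ b u v → a = b
  acyclic : (cutGraph Λ₀ Ψ Λ).IsAcyclic

end Ludics

end

noncomputable section

namespace Ludics

open Relation

/-! ### The layers of a positive pseudo-design -/

/-! Both sides perform the same cuts, differently scheduled. Consider `⟦⟦φ, A⟧, E⟧` against `⟦φ,
F⟧`, and let the root of `φ` have focus `ξ`. If `A` accepts `ξ`, the inner machine makes the cut
that the single machine makes, and the value `⟦φ, A⟧` does not change. If `A` refuses `ξ`, this root
is that of `⟦φ, A⟧`, and the outer machine either cuts it with an element of `E` or, when `F`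
refuses `ξ` too, outputs it on both sides.

An outer cut sends normal forms `⟦c i J, A⟧` into the outer set, so the invariant `Nested` lets
every relevant element of `E` be the normal form of an element of `F` against a private set of its
own. After such a cut, several subtrees hold the same set `A`; what is divided among them is not the
designs but the addresses through which designs are called. Disjointness of the right-hand sides
makes the addresses reachable from distinct subtrees disjoint (`Reach.disjoint`), so no two of them
compete for one design. Designs whose focus nobody owns may linger harmlessly.

`Nested.cut_inner`, `Nested.cut_outer` and `Nested.head` preserve the invariant. Termination of the
single machine passes to both nested ones (`Simulates.exists_outputs`), and an output of the nested
pair is matched by the single machine (`Simulates.matched`), divergence counting as `Ω`. Hence the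
invariant yields a bisimulation (`Simulates.normalForm_eq`); the net of the theorem satisfies it at
the start (`IsNet.simulates`). -/

theorem PosDesign.dest_omega : PFunctor.M.dest PosDesign.omega = omegaLayer PosDesign :=
  PFunctor.M.dest_mk _

theorem PosDesign.dest_daimon : PFunctor.M.dest PosDesign.daimon = daimonLayer PosDesign :=
  PFunctor.M.dest_mk _

theorem PosDesign.dest_node (ξ : Address) (I : Finset ℕ)
    (c : {i // i ∈ I} → Finset ℕ → PosDesign) :
    PFunctor.M.dest (PosDesign.node ξ I c) = nodeLayer ξ I c :=
  PFunctor.M.dest_mk _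

theorem nodeLayer_inj {X : Type} {ξ ξ' : Address} {I I' : Finset ℕ}
    {c : {i // i ∈ I} → Finset ℕ → X} {c' : {i // i ∈ I'} → Finset ℕ → X}
    (h : nodeLayer ξ I c = nodeLayer ξ' I' c') : ξ = ξ' ∧ I = I' ∧ HEq c c' := by
  unfold nodeLayer at h
  obtain ⟨h1, h2⟩ := Sigma.mk.inj h
  obtain ⟨rfl, rfl⟩ := PosAction.proper.inj h1
  refine ⟨rfl, rfl, heq_of_eq ?_⟩
  funext i J
  exact congrFun (eq_of_heq h2) (i, J)

theorem PosDesign.node_inj {ξ ξ' : Address} {I I' : Finset ℕ}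
    {c : {i // i ∈ I} → Finset ℕ → PosDesign} {c' : {i // i ∈ I'} → Finset ℕ → PosDesign}
    (h : PosDesign.node ξ I c = PosDesign.node ξ' I' c') : ξ = ξ' ∧ I = I' ∧ HEq c c' := by
  have := congrArg PFunctor.M.dest h
  rw [dest_node, dest_node] at this
  exact nodeLayer_inj this

theorem PosDesign.omega_ne_daimon : PosDesign.omega ≠ PosDesign.daimon := by
  intro h
  have := congrArg (fun x => (PFunctor.M.dest x).1) h
  simp only [dest_omega, dest_daimon] at this
  exact PosAction.noConfusion this

theorem PosDesign.omega_ne_node {ξ : Address} {I : Finset ℕ}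
    {c : {i // i ∈ I} → Finset ℕ → PosDesign} : PosDesign.omega ≠ PosDesign.node ξ I c := by
  intro h
  have := congrArg (fun x => (PFunctor.M.dest x).1) h
  simp only [dest_omega, dest_node] at this
  exact PosAction.noConfusion this

theorem PosDesign.daimon_ne_node {ξ : Address} {I : Finset ℕ}
    {c : {i // i ∈ I} → Finset ℕ → PosDesign} : PosDesign.daimon ≠ PosDesign.node ξ I c := by
  intro h
  have := congrArg (fun x => (PFunctor.M.dest x).1) h
  simp only [dest_daimon, dest_node] at this
  exact PosAction.noConfusion this

theorem layer_cases {X : Type} (o : designFunctor.Obj X) :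
    o = omegaLayer X ∨ o = daimonLayer X ∨ ∃ ξ I c, o = nodeLayer ξ I c := by
  rcases o with ⟨_ | _ | ⟨ξ, I⟩, f⟩
  · left
    exact Sigma.ext rfl (heq_of_eq (funext fun e => e.elim))
  · right; left
    exact Sigma.ext rfl (heq_of_eq (funext fun e => e.elim))
  · right; right
    exact ⟨ξ, I, fun i J => f (i, J), rfl⟩

theorem PosDesign.cases (φ : PosDesign) :
    φ = PosDesign.omega ∨ φ = PosDesign.daimon ∨ ∃ ξ I c, φ = PosDesign.node ξ I c := by
  have key := PFunctor.M.mk_dest φ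
  rcases layer_cases (PFunctor.M.dest φ) with h | h | ⟨ξ, I, c, h⟩ <;> rw [h] at key
  · exact Or.inl key.symm
  · exact Or.inr (Or.inl key.symm)
  · exact Or.inr (Or.inr ⟨ξ, I, c, key.symm⟩)

/-! ### The weak machine -/

theorem Step.node_inv {ξ : Address} {I : Finset ℕ} {c : {i // i ∈ I} → Finset ℕ → PosDesign}
    {Ψ : Set NegDesign} {t : State} (h : Step (PosDesign.node ξ I c, Ψ) t) :
    ∃ ψ ∈ Ψ, ψ.focus = ξ ∧ t = (ψ.body I, negChildren ξ I c ∪ remove Ψ ξ) := by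
  generalize hs : (PosDesign.node ξ I c, Ψ) = s at h
  cases h with
  | cut hψ hξ =>
    obtain ⟨h1, rfl⟩ := Prod.mk.inj hs
    obtain ⟨rfl, rfl, h3⟩ := PosDesign.node_inj h1
    obtain rfl := eq_of_heq h3
    exact ⟨_, hψ, hξ, rfl⟩

theorem Step.exists_node {s t : State} (h : Step s t) :
    ∃ ξ I c, s.1 = PosDesign.node ξ I c := by
  cases h
  exact ⟨_, _, _, rfl⟩

theorem not_step_omega {Ψ : Set NegDesign} {t : State} : ¬ Step (PosDesign.omega, Ψ) t := by
  intro h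
  obtain ⟨ξ, I, c, h⟩ := h.exists_node
  exact PosDesign.omega_ne_node h

theorem not_step_daimon {Ψ : Set NegDesign} {t : State} : ¬ Step (PosDesign.daimon, Ψ) t := by
  intro h
  obtain ⟨ξ, I, c, h⟩ := h.exists_node
  exact PosDesign.daimon_ne_node h

theorem Final.omega_inv {Ψ : Set NegDesign} {o : designFunctor.Obj State}
    (h : Final (PosDesign.omega, Ψ) o) : o = omegaLayer State := by
  generalize hs : (PosDesign.omega, Ψ) = s at h
  cases h with
  | omega => rfl
  | daimon => exact absurd (Prod.mk.inj hs).1 PosDesign.omega_ne_daimon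
  | head => exact absurd (Prod.mk.inj hs).1 PosDesign.omega_ne_node

theorem Final.daimon_inv {Ψ : Set NegDesign} {o : designFunctor.Obj State}
    (h : Final (PosDesign.daimon, Ψ) o) : o = daimonLayer State := by
  generalize hs : (PosDesign.daimon, Ψ) = s at h
  cases h with
  | omega => exact absurd (Prod.mk.inj hs).1.symm PosDesign.omega_ne_daimon
  | daimon => rfl
  | head => exact absurd (Prod.mk.inj hs).1 PosDesign.daimon_ne_node

theorem Final.node_inv {ξ : Address} {I : Finset ℕ} {c : {i // i ∈ I} → Finset ℕ → PosDesign}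
    {Ψ : Set NegDesign} {o : designFunctor.Obj State} (h : Final (PosDesign.node ξ I c, Ψ) o) :
    ¬ Accepts Ψ ξ ∧ o = nodeLayer ξ I fun i J => (c i J, Ψ) := by
  generalize hs : (PosDesign.node ξ I c, Ψ) = s at h
  cases h with
  | omega => exact absurd (Prod.mk.inj hs).1.symm PosDesign.omega_ne_node
  | daimon => exact absurd (Prod.mk.inj hs).1.symm PosDesign.daimon_ne_node
  | head hξ =>
    obtain ⟨h1, rfl⟩ := Prod.mk.inj hs
    obtain ⟨rfl, rfl, h3⟩ := PosDesign.node_inj h1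
    obtain rfl := eq_of_heq h3
    exact ⟨hξ, rfl⟩

theorem Final.not_step {s t : State} {o : designFunctor.Obj State} (h : Final s o) :
    ¬ Step s t := by
  cases h with
  | omega => exact not_step_omega
  | daimon => exact not_step_daimon
  | head hξ =>
    intro hs
    obtain ⟨ψ, hψ, hf, -⟩ := hs.node_inv
    exact hξ ⟨ψ, hψ, hf⟩

theorem Final.unique {s : State} {o o' : designFunctor.Obj State} (h : Final s o)
    (h' : Final s o') : o = o' := by
  cases h with
  | omega => exact h'.omega_inv.symm
  | daimon => exact h'.daimon_inv.symm
  | head hξ => exact h'.node_inv.2.symm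

theorem Outputs.of_step {s t : State} {o : designFunctor.Obj State} (h : Step s t)
    (ht : Outputs t o) : Outputs s o := by
  obtain ⟨u, h1, h2⟩ := ht
  exact ⟨u, ReflTransGen.head h h1, h2⟩

theorem Outputs.of_final {s : State} {o : designFunctor.Obj State} (h : Final s o) :
    Outputs s o :=
  ⟨s, ReflTransGen.refl, h⟩

theorem Outputs.eq_of_final {s : State} {o o' : designFunctor.Obj State} (h : Final s o)
    (h' : Outputs s o') : o' = o := by
  obtain ⟨u, h1, h2⟩ := h'
  rcases ReflTransGen.cases_head h1 with rfl | ⟨v, h3, -⟩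
  · exact h2.unique h
  · exact absurd h3 h.not_step

/-- The weak machine is deterministic on every state that it reaches from `s`. -/
def Det (s : State) : Prop :=
  ∀ t, ReflTransGen Step s t → ∀ u v, Step t u → Step t v → u = v

theorem Det.of_step {s t : State} (hd : Det s) (h : Step s t) : Det t :=
  fun _ ht => hd _ (ReflTransGen.head h ht)

theorem Det.outputs_step {s t : State} {o : designFunctor.Obj State} (hd : Det s)
    (h : Step s t) (ho : Outputs s o) : Outputs t o := by
  obtain ⟨u, h1, h2⟩ := ho
  rcases ReflTransGen.cases_head h1 with rfl | ⟨v, h3, h4⟩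
  · exact absurd h h2.not_step
  · obtain rfl := hd _ ReflTransGen.refl _ _ h h3
    exact ⟨u, h4, h2⟩

theorem Det.outputs_unique {s : State} {o o' : designFunctor.Obj State} (hd : Det s)
    (h : Outputs s o) (h' : Outputs s o') : o = o' := by
  obtain ⟨t, h1, h2⟩ := h
  induction h1 using ReflTransGen.head_induction_on with
  | refl => exact (Outputs.eq_of_final h2 h').symm
  | head hs _ ih => exact ih (hd.of_step hs) (hd.outputs_step hs h')

theorem observe_spec {s : State} {o : designFunctor.Obj State} (h : Outputs s o) :
    Outputs s (observe s) := by
  have hex : ∃ o, Outputs s o := ⟨o, h⟩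
  unfold observe
  rw [dif_pos hex]
  exact hex.choose_spec

theorem observe_of_not {s : State} (h : ¬ ∃ o, Outputs s o) : observe s = omegaLayer State := by
  unfold observe
  rw [dif_neg h]

theorem observe_final {s : State} {o : designFunctor.Obj State} (h : Final s o) :
    observe s = o :=
  Outputs.eq_of_final h (observe_spec (Outputs.of_final h))

theorem Det.observe_eq {s : State} {o : designFunctor.Obj State} (hd : Det s)
    (h : Outputs s o) : observe s = o :=
  hd.outputs_unique (observe_spec h) h

/-- Divergence is covered as well: under determinism a step neither creates nor destroys an output,
and without output both observations default to `Ω`. -/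
theorem Det.observe_step {s t : State} (hd : Det s) (h : Step s t) : observe s = observe t := by
  by_cases hex : ∃ o, Outputs t o
  · obtain ⟨o, ho⟩ := hex
    rw [hd.observe_eq (Outputs.of_step h ho), (hd.of_step h).observe_eq ho]
  · rw [observe_of_not hex, observe_of_not]
    rintro ⟨o, ho⟩
    exact hex ⟨o, hd.outputs_step h ho⟩

/-! ### Unfolding the normal form -/

theorem dest_normalForm (φ : PosDesign) (Ψ : Set NegDesign) :
    PFunctor.M.dest (normalForm φ Ψ) =
      designFunctor.map (fun s : State => normalForm s.1 s.2) (observe (φ, Ψ)) :=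
  PFunctor.M.dest_corec _ _

theorem PosDesign.ext_dest {φ φ' : PosDesign}
    (h : PFunctor.M.dest φ = PFunctor.M.dest φ') : φ = φ' := by
  rw [← PFunctor.M.mk_dest φ, h, PFunctor.M.mk_dest]

theorem map_omegaLayer {X Y : Type} (f : X → Y) :
    designFunctor.map f (omegaLayer X) = omegaLayer Y :=
  Sigma.ext rfl (heq_of_eq (funext fun e => e.elim))

theorem map_daimonLayer {X Y : Type} (f : X → Y) :
    designFunctor.map f (daimonLayer X) = daimonLayer Y :=
  Sigma.ext rfl (heq_of_eq (funext fun e => e.elim))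

theorem map_nodeLayer {X Y : Type} (f : X → Y) (ξ : Address) (I : Finset ℕ)
    (c : {i // i ∈ I} → Finset ℕ → X) :
    designFunctor.map f (nodeLayer ξ I c) = nodeLayer ξ I fun i J => f (c i J) :=
  rfl

theorem normalForm_step {φ φ' : PosDesign} {Ψ Ψ' : Set NegDesign} (hd : Det (φ, Ψ))
    (h : Step (φ, Ψ) (φ', Ψ')) : normalForm φ Ψ = normalForm φ' Ψ' := by
  apply PosDesign.ext_dest
  rw [dest_normalForm, dest_normalForm, hd.observe_step h]

theorem normalForm_of_not_outputs {φ : PosDesign} {Ψ : Set NegDesign}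
    (h : ¬ ∃ o, Outputs (φ, Ψ) o) : normalForm φ Ψ = PosDesign.omega := by
  apply PosDesign.ext_dest
  rw [dest_normalForm, observe_of_not h, map_omegaLayer, PosDesign.dest_omega]

theorem normalForm_omega (Ψ : Set NegDesign) :
    normalForm PosDesign.omega Ψ = PosDesign.omega := by
  apply PosDesign.ext_dest
  rw [dest_normalForm, observe_final Final.omega, map_omegaLayer, PosDesign.dest_omega]

theorem normalForm_daimon (Ψ : Set NegDesign) :
    normalForm PosDesign.daimon Ψ = PosDesign.daimon := by
  apply PosDesign.ext_dest
  rw [dest_normalForm, observe_final Final.daimon, map_daimonLayer, PosDesign.dest_daimon]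

theorem normalForm_head {ξ : Address} {I : Finset ℕ}
    {c : {i // i ∈ I} → Finset ℕ → PosDesign} {Ψ : Set NegDesign} (h : ¬ Accepts Ψ ξ) :
    normalForm (PosDesign.node ξ I c) Ψ =
      PosDesign.node ξ I fun i J => normalForm (c i J) Ψ := by
  apply PosDesign.ext_dest
  rw [dest_normalForm, observe_final (Final.head h), map_nodeLayer, PosDesign.dest_node]

/-- With nothing to cut against, normalization copies each layer. This lets an original design count
as a normal form when the simulation starts. -/
theorem normalForm_empty (φ : PosDesign) : normalForm φ ∅ = φ := by
  refine PFunctor.M.bisim (fun x y => x = normalForm y ∅) ?_ _ _ rfl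
  rintro _ φ rfl
  rcases PosDesign.cases φ with rfl | rfl | ⟨ξ, I, c, rfl⟩
  · rw [normalForm_omega, PosDesign.dest_omega]
    exact ⟨_, _, _, rfl, rfl, fun e => e.elim⟩
  · rw [normalForm_daimon, PosDesign.dest_daimon]
    exact ⟨_, _, _, rfl, rfl, fun e => e.elim⟩
  · rw [normalForm_head (by rintro ⟨ψ, h, -⟩; exact h), PosDesign.dest_node, PosDesign.dest_node]
    exact ⟨_, _, _, rfl, rfl, fun p => rfl⟩

/-! ### Typing up to weakening -/

/-- `φ` has a type with addresses in `T`. -/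
def PosOK (φ : PosDesign) (T : Set Address) : Prop :=
  ∃ Λ : Finset Address, ↑Λ ⊆ T ∧ HasPosType φ Λ

/-- `ψ` has a type with right addresses in `T`. -/
def NegOK (ψ : NegDesign) (T : Set Address) : Prop :=
  ∀ J, PosOK (ψ.body J) (↑(Address.star ψ.focus J) ∪ T)

theorem PosOK.mono {φ : PosDesign} {T T' : Set Address} (h : PosOK φ T) (hT : T ⊆ T') :
    PosOK φ T' := by
  obtain ⟨Λ, h1, h2⟩ := h
  exact ⟨Λ, h1.trans hT, h2⟩

theorem NegRule.mono {R R' : PosDesign → Finset Address → Prop} (h : ∀ φ Λ, R φ Λ → R' φ Λ)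
    {ψ : NegDesign} {Λ : Finset Address} (hψ : NegRule R ψ Λ) : NegRule R' ψ Λ := by
  refine ⟨hψ.1, fun J => ?_⟩
  obtain ⟨ΛJ, h1, h2⟩ := hψ.2 J
  exact ⟨ΛJ, h1, h _ _ h2⟩

theorem HasNegType.negOK {ψ : NegDesign} {Λ : Finset Address} (h : HasNegType ψ Λ) :
    NegOK ψ ↑Λ := by
  intro J
  obtain ⟨ΛJ, h1, h2⟩ := h.2 J
  refine ⟨_, ?_, h2⟩
  rw [Finset.coe_union]
  exact Set.union_subset_union_right _ (Finset.coe_subset.2 h1)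

/-- The addresses available to `(+, ξ, I)` are shared out between its immediate subtrees. -/
structure IsSplit (ξ : Address) (I : Finset ℕ) (c : {i // i ∈ I} → Finset ℕ → PosDesign)
    (T : Set Address) (Ti : {i // i ∈ I} → Set Address) : Prop where
  mem : ξ ∈ T
  sub : ∀ i, Ti i ⊆ T \ {ξ}
  disj : ∀ i j a, a ∈ Ti i → a ∈ Ti j → i = j
  typed : ∀ i : {i // i ∈ I}, NegOK ⟨Address.ext ξ i, c i⟩ (Ti i)

theorem PosOK.exists_isSplit {ξ : Address} {I : Finset ℕ}
    {c : {i // i ∈ I} → Finset ℕ → PosDesign} {T : Set Address}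
    (h : PosOK (PosDesign.node ξ I c) T) : ∃ Ti, IsSplit ξ I c T Ti := by
  obtain ⟨Λ, hT, R, hR, hφ⟩ := h
  have hr := hR _ _ hφ
  generalize hs : PosDesign.node ξ I c = φ at hr
  cases hr with
  | omega => exact absurd hs.symm PosDesign.omega_ne_node
  | daimon => exact absurd hs.symm PosDesign.daimon_ne_node
  | @node ξ' I' c' Λ Λi hsub hdisj hξ hwf hneg =>
    obtain ⟨rfl, rfl, h3⟩ := PosDesign.node_inj hs
    obtain rfl := eq_of_heq h3
    refine ⟨fun i => ↑(Λi i), hT (by simp), ?_, ?_, ?_⟩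
    · intro i a ha
      have ha' : a ∈ Λ := hsub i ha
      refine ⟨hT (by simp [ha']), ?_⟩
      rintro rfl
      exact hξ ha'
    · intro i j a hi hj
      by_contra hne
      exact Finset.disjoint_left.1 (hdisj i j hne) hi hj
    · intro i
      -- The relation `R` that witnesses the typing of the node also types everything above it.
      exact HasNegType.negOK (NegRule.mono (fun φ Λ hφ => ⟨R, hR, hφ⟩) (hneg i))

/-! ### Addresses below a focus -/

theorem Address.mem_star {ξ a : Address} {J : Finset ℕ} :
    a ∈ Address.star ξ J ↔ ∃ i ∈ J, Address.ext ξ i = a := by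
  simp [Address.star]

theorem Address.ext_inj {ξ : Address} {i j : ℕ} (h : Address.ext ξ i = Address.ext ξ j) :
    i = j := by
  simpa [Address.ext] using h

theorem Address.prefix_ext (ξ : Address) (i : ℕ) : ξ <+: Address.ext ξ i :=
  List.prefix_append _ _

theorem Address.ext_ne (ξ : Address) (i : ℕ) : Address.ext ξ i ≠ ξ := by
  simp [Address.ext]

theorem Address.prefix_ext_iff {a ξ : Address} {i : ℕ} :
    a <+: Address.ext ξ i ↔ a = Address.ext ξ i ∨ a <+: ξ := by
  simpa [Address.ext] using List.prefix_concat_iff (l₁ := a) (l₂ := ξ) (a := i)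

/-- No element of `P` is a proper prefix of an element of `D`. -/
def NoPrefix (P D : Set Address) : Prop :=
  ∀ a ∈ P, ∀ x ∈ D, a <+: x → a = x

/-- Freshness: the addresses created by a cut on `ξ` collide with no address or focus already
present. -/
theorem NoPrefix.ext_notMem {P D : Set Address} (h : NoPrefix P D) {ξ : Address} (hξ : ξ ∈ P)
    (i : ℕ) : Address.ext ξ i ∉ D := by
  intro hD
  exact Address.ext_ne ξ i (h ξ hξ _ hD (Address.prefix_ext ξ i)).symm

theorem NoPrefix.mono {P P' D D' : Set Address} (h : NoPrefix P D) (hP : P' ⊆ P)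
    (hD : D' ⊆ D) : NoPrefix P' D' :=
  fun a ha x hx => h a (hP ha) x (hD hx)

/-- Replacing `ξ` by addresses immediately above it. -/
theorem NoPrefix.replace {P D : Set Address} (h : NoPrefix P D) (hPD : P ⊆ D) {ξ : Address}
    (hξ : ξ ∈ P) (I : Finset ℕ) :
    NoPrefix (P \ {ξ} ∪ ↑(Address.star ξ I)) (D ∪ ↑(Address.star ξ I)) := by
  rintro a ha x hx hax
  rcases ha with ⟨haP, hne⟩ | ha
  · rcases hx with hx | hx
    · exact h a haP x hx hax
    · obtain ⟨i, -, rfl⟩ := Address.mem_star.1 hx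
      rcases Address.prefix_ext_iff.1 hax with h1 | h1
      · exact h1
      · exact absurd (h a haP ξ (hPD hξ) h1) hne
  · obtain ⟨i, -, rfl⟩ := Address.mem_star.1 ha
    rcases hx with hx | hx
    · have := h ξ hξ x hx ((Address.prefix_ext ξ i).trans hax)
      subst this
      exact absurd (hax.eq_of_length_le (by simp [Address.ext])) (Address.ext_ne _ i)
    · obtain ⟨j, -, rfl⟩ := Address.mem_star.1 hx
      exact hax.eq_of_length (by simp [Address.ext])

/-! ### Reduction of nets -/

/-- The foci of the elements of `Ψ`. -/
def foci (Ψ : Set NegDesign) : Set Address := {x | Accepts Ψ x}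

theorem mem_foci {Ψ : Set NegDesign} {ψ : NegDesign} (h : ψ ∈ Ψ) : ψ.focus ∈ foci Ψ :=
  ⟨ψ, h, rfl⟩

theorem foci_next {ξ : Address} {I : Finset ℕ} {c : {i // i ∈ I} → Finset ℕ → PosDesign}
    {Ψ : Set NegDesign} {x : Address} (hx : x ∈ foci (negChildren ξ I c ∪ remove Ψ ξ)) :
    x ∈ Address.star ξ I ∨ (x ∈ foci Ψ ∧ x ≠ ξ) := by
  obtain ⟨ψ, (⟨i, rfl⟩ | ⟨h1, h2⟩), rfl⟩ := hx
  · exact Or.inl (Address.mem_star.2 ⟨i, i.2, rfl⟩)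
  · exact Or.inr ⟨mem_foci h1, h2⟩

/-- The right addresses after a cut on `ξ`. -/
def cutRight (ξ : Address) (I : Finset ℕ) (S : Option Address → Set Address)
    (Ti : {i // i ∈ I} → Set Address) : Option Address → Set Address
  | none => ↑(Address.star ξ I) ∪ S (some ξ)
  | some x => {a | (∃ i : {i // i ∈ I}, x = Address.ext ξ i ∧ a ∈ Ti i) ∨
      (x ≠ ξ ∧ (∀ i ∈ I, x ≠ Address.ext ξ i) ∧ a ∈ S (some x))}

theorem cutRight_ext {ξ : Address} {I : Finset ℕ} {S : Option Address → Set Address}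
    {Ti : {i // i ∈ I} → Set Address} (i : {i // i ∈ I}) :
    cutRight ξ I S Ti (some (Address.ext ξ i)) = Ti i := by
  ext a
  constructor
  · rintro (⟨j, h1, h2⟩ | ⟨-, h, -⟩)
    · obtain rfl : i = j := Subtype.ext (Address.ext_inj h1)
      exact h2
    · exact absurd rfl (h i i.2)
  · exact fun ha => Or.inl ⟨i, rfl, ha⟩

theorem cutRight_of_ne {ξ x : Address} {I : Finset ℕ} {S : Option Address → Set Address}
    {Ti : {i // i ∈ I} → Set Address} (h1 : x ≠ ξ) (h2 : x ∉ Address.star ξ I) :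
    cutRight ξ I S Ti (some x) = S (some x) := by
  have h3 : ∀ i ∈ I, x ≠ Address.ext ξ i :=
    fun i hi h => h2 (Address.mem_star.2 ⟨i, hi, h.symm⟩)
  ext a
  constructor
  · rintro (⟨j, h4, -⟩ | ⟨-, -, h⟩)
    · exact absurd h4 (h3 j j.2)
    · exact h
  · exact fun ha => Or.inr ⟨h1, h3, ha⟩

/-- Addresses are moved, never copied: those of the design cut on `ξ` pass to the root, those of the
old root are split among its subtrees, and the addresses `ξ i` are new. -/
theorem cutRight_disj {ξ : Address} {I : Finset ℕ}
    {c : {i // i ∈ I} → Finset ℕ → PosDesign} {S : Option Address → Set Address}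
    {Ti : {i // i ∈ I} → Set Address}
    (disj : ∀ g h a, a ∈ S g → a ∈ S h → g = h)
    (hstar : ∀ g, ∀ a ∈ S g, a ∉ Address.star ξ I)
    (hTi : IsSplit ξ I c (S none) Ti) :
    ∀ g h a, a ∈ cutRight ξ I S Ti g → a ∈ cutRight ξ I S Ti h → g = h := by
  have key : ∀ x a, a ∈ cutRight ξ I S Ti none → a ∉ cutRight ξ I S Ti (some x) := by
    rintro x a (ha | ha) (⟨i, rfl, h⟩ | ⟨h1, h2, h⟩)
    · exact hstar _ _ (hTi.sub i h).1 ha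
    · exact hstar _ _ h ha
    · exact absurd (disj _ _ _ ha (hTi.sub i h).1) (by simp)
    · exact h1 (Option.some.inj (disj _ _ _ h ha))
  rintro (_ | x) (_ | y) a hx hy
  · rfl
  · exact absurd hy (key y a hx)
  · exact absurd hx (key x a hy)
  · rcases hx with ⟨i, rfl, h⟩ | ⟨h1, h2, h⟩ <;> rcases hy with ⟨j, rfl, h'⟩ | ⟨h1', h2', h'⟩
    · rw [hTi.disj i j a h h']
    · exact absurd (disj _ _ _ h' (hTi.sub i h).1) (by simp)
    · exact absurd (disj _ _ _ h (hTi.sub j h').1) (by simp)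
    · exact disj _ _ _ h h'

/-- `φ` and `Ψ` form a typed net, up to elements of `Ψ` with focus outside of `P`, which play no
role: `P` contains the right addresses, `S none` those of `φ`, and `S (some x)` those of the
element of `Ψ` with focus `x`. -/
structure GoodData (φ : PosDesign) (Ψ : Set NegDesign) (P : Set Address)
    (S : Option Address → Set Address) : Prop where
  typed_pos : PosOK φ (S none)
  typed_neg : ∀ ψ ∈ Ψ, ψ.focus ∈ P → NegOK ψ (S (some ψ.focus))
  sub : ∀ g, S g ⊆ P
  uniq : ∀ ψ ∈ Ψ, ∀ ψ' ∈ Ψ, ψ.focus ∈ P → ψ'.focus = ψ.focus → ψ' = ψ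
  disj : ∀ g h a, a ∈ S g → a ∈ S h → g = h
  noPrefix : NoPrefix P (P ∪ foci Ψ)

/-- Subject reduction. The negative rule types the body chosen by `I`, and the positive rule types
the subtrees that join `Ψ`; freshness of `ξ ⋆ I` keeps these apart from the old elements, which
preserves uniqueness of foci. -/
theorem GoodData.cut {ξ : Address} {I : Finset ℕ} {c : {i // i ∈ I} → Finset ℕ → PosDesign}
    {Ψ : Set NegDesign} {P : Set Address} {S : Option Address → Set Address}
    (h : GoodData (PosDesign.node ξ I c) Ψ P S) {Ti : {i // i ∈ I} → Set Address}
    (hTi : IsSplit ξ I c (S none) Ti) {ψ : NegDesign} (hψ : ψ ∈ Ψ) (hξ : ψ.focus = ξ) :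
    GoodData (ψ.body I) (negChildren ξ I c ∪ remove Ψ ξ) (P \ {ξ} ∪ ↑(Address.star ξ I))
      (cutRight ξ I S Ti) := by
  have hξP : ξ ∈ P := h.sub _ hTi.mem
  have hstar : ∀ x ∈ Address.star ξ I, x ∉ P ∪ foci Ψ := by
    intro x hx
    obtain ⟨i, -, rfl⟩ := Address.mem_star.1 hx
    exact h.noPrefix.ext_notMem hξP i
  have hstarS : ∀ g, ∀ a ∈ S g, a ∉ Address.star ξ I :=
    fun g a ha hs => hstar a hs (Or.inl (h.sub g ha))
  refine ⟨?_, ?_, ?_, ?_, cutRight_disj h.disj hstarS hTi, ?_⟩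
  · subst hξ
    exact h.typed_neg ψ hψ hξP I
  · rintro ψ' (⟨i, rfl⟩ | ⟨hψ', hne⟩) hP
    · rw [cutRight_ext]
      exact hTi.typed i
    · have h1 : ψ'.focus ∉ Address.star ξ I := fun hs => hstar _ hs (Or.inr (mem_foci hψ'))
      rw [cutRight_of_ne hne h1]
      exact h.typed_neg ψ' hψ' (hP.resolve_right h1).1
  · have hne : ∀ x, x ≠ none → ∀ a ∈ S x, a ≠ ξ := by
      rintro x hx a ha rfl
      exact hx (h.disj _ _ _ ha hTi.mem)
    rintro (_ | x) a ha
    · rcases ha with ha | ha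
      · exact Or.inr ha
      · exact Or.inl ⟨h.sub _ ha, hne _ (by simp) a ha⟩
    · rcases ha with ⟨i, -, ha⟩ | ⟨-, -, ha⟩
      · exact Or.inl ⟨h.sub _ (hTi.sub i ha).1, (hTi.sub i ha).2⟩
      · exact Or.inl ⟨h.sub _ ha, hne _ (by simp) a ha⟩
  · rintro ψ₁ (⟨i, rfl⟩ | ⟨h1, hne1⟩) ψ₂ (⟨j, rfl⟩ | ⟨h2, hne2⟩) hP heq
    · have : j = i := Subtype.ext (Address.ext_inj heq)
      rw [this]
    · exact absurd (Or.inr (mem_foci h2))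
        (hstar _ (Address.mem_star.2 ⟨i, i.2, heq.symm⟩))
    · exact absurd (Or.inr (mem_foci h1))
        (hstar _ (Address.mem_star.2 ⟨j, j.2, heq⟩))
    · refine h.uniq ψ₁ h1 ψ₂ h2 (hP.resolve_right fun hs => ?_).1 heq
      exact hstar _ hs (Or.inr (mem_foci h1))
  · refine (h.noPrefix.replace Set.subset_union_left hξP I).mono subset_rfl ?_
    rintro x ((hx | hx) | hx)
    · exact Or.inl (Or.inl hx.1)
    · exact Or.inr hx
    · rcases foci_next hx with hx | hx
      · exact Or.inr hx
      · exact Or.inl (Or.inr hx.1)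

/-- The right addresses above the negative action `(-, ξ i, J)`. -/
def headRight (ζ : Address) (J : Finset ℕ) (S : Option Address → Set Address)
    (T : Set Address) : Option Address → Set Address
  | none => ↑(Address.star ζ J) ∪ T
  | some x => S (some x)

theorem GoodData.head {ξ : Address} {I : Finset ℕ} {c : {i // i ∈ I} → Finset ℕ → PosDesign}
    {Ψ : Set NegDesign} {P : Set Address} {S : Option Address → Set Address}
    (h : GoodData (PosDesign.node ξ I c) Ψ P S) {Ti : {i // i ∈ I} → Set Address}
    (hTi : IsSplit ξ I c (S none) Ti) (i : {i // i ∈ I}) (J : Finset ℕ) :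
    GoodData (c i J) Ψ (P \ {ξ} ∪ ↑(Address.star (Address.ext ξ i) J))
      (headRight (Address.ext ξ i) J S (Ti i)) := by
  have hξP : ξ ∈ P := h.sub _ hTi.mem
  have hstar : ∀ x ∈ Address.star (Address.ext ξ i) J, x ∉ P ∪ foci Ψ := by
    intro x hx hD
    obtain ⟨j, -, rfl⟩ := Address.mem_star.1 hx
    have h1 : ξ <+: Address.ext (Address.ext ξ i) j :=
      (Address.prefix_ext ξ i).trans (Address.prefix_ext _ j)
    have h2 := h.noPrefix ξ hξP _ hD h1
    have h3 := congrArg List.length h2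
    simp [Address.ext] at h3
  refine ⟨hTi.typed i J, ?_, ?_, ?_, ?_, ?_⟩
  · intro ψ hψ hP
    exact h.typed_neg ψ hψ (hP.resolve_right fun hs => hstar _ hs (Or.inr (mem_foci hψ))).1
  · rintro (_ | x) a ha
    · rcases ha with ha | ha
      · exact Or.inr ha
      · exact Or.inl ⟨h.sub _ (hTi.sub i ha).1, (hTi.sub i ha).2⟩
    · refine Or.inl ⟨h.sub _ ha, ?_⟩
      rintro rfl
      exact absurd (h.disj _ _ _ ha hTi.mem) (by simp)
  · intro ψ hψ ψ' hψ' hP heq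
    exact h.uniq ψ hψ ψ' hψ' (hP.resolve_right fun hs => hstar _ hs (Or.inr (mem_foci hψ))).1 heq
  · have key : ∀ x a, a ∈ headRight (Address.ext ξ i) J S (Ti i) none → a ∉ S (some x) := by
      rintro x a (ha | ha) hx
      · exact hstar a ha (Or.inl (h.sub _ hx))
      · exact absurd (h.disj _ _ _ hx (hTi.sub i ha).1) (by simp)
    rintro (_ | x) (_ | y) a hx hy
    · rfl
    · exact absurd hy (key y a hx)
    · exact absurd hx (key x a hy)
    · exact h.disj _ _ a hx hy
  -- `NoPrefix.replace` climbs by one letter, while (S) climbs by two: `ξ` is replaced by `ξ i`,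
  -- which is then replaced by `ξ i ⋆ J`.
  · have h1 := h.noPrefix.replace Set.subset_union_left hξP {(i : ℕ)}
    have hmem : Address.ext ξ i ∈ Address.star ξ {(i : ℕ)} :=
      Address.mem_star.2 ⟨i, by simp, rfl⟩
    have h2 := h1.replace (Set.union_subset_union_left _
      (Set.sdiff_subset.trans Set.subset_union_left)) (Or.inr hmem) J
    refine h2.mono ?_ ?_
    · rintro x (hx | hx)
      · refine Or.inl ⟨Or.inl hx, ?_⟩
        rintro rfl
        exact h.noPrefix.ext_notMem hξP i (Or.inl hx.1)
      · exact Or.inr hx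
    · rintro x ((hx | hx) | hx)
      · exact Or.inl (Or.inl (Or.inl hx.1))
      · exact Or.inr hx
      · exact Or.inl (Or.inl (Or.inr hx))

/-- `φ` and `Ψ` form a typed net for some choice of the bases. -/
def Good (s : State) : Prop := ∃ P S, GoodData s.1 s.2 P S

theorem Good.step {s t : State} (hs : Good s) (h : Step s t) : Good t := by
  obtain ⟨P, S, hd⟩ := hs
  cases h with
  | cut hψ hξ =>
    obtain ⟨Ti, hTi⟩ := hd.typed_pos.exists_isSplit
    exact ⟨_, _, hd.cut hTi hψ hξ⟩

/-- By typing, the focus of the root is a right address of `φ`, hence in `P`, where elements of `Ψ`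
are determined by their foci. -/
theorem Good.step_unique {s t u : State} (hs : Good s) (h : Step s t) (h' : Step s u) :
    t = u := by
  obtain ⟨P, S, hd⟩ := hs
  cases h with
  | cut hψ hξ =>
    obtain ⟨Ti, hTi⟩ := hd.typed_pos.exists_isSplit
    obtain ⟨ψ', hψ', hξ', rfl⟩ := h'.node_inv
    subst hξ
    rw [hd.uniq _ hψ ψ' hψ' (hd.sub _ hTi.mem) hξ']

theorem Good.det {s : State} (hs : Good s) : Det s := by
  have key : ∀ t, ReflTransGen Step s t → Good t := by
    intro t ht
    induction ht with
    | refl => exact hs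
    | tail _ h ih => exact ih.step h
  exact fun t ht u v => (key t ht).step_unique

/-! ### Comparing two nested normalizations with a single one -/

/-- The addresses reachable from `T`, following the right addresses of the elements of `A`. -/
inductive Reach (A : Set NegDesign) (S : Option Address → Set Address) (T : Set Address) :
    Address → Prop
  | base {a : Address} (h : a ∈ T) : Reach A S T a
  | step {x a : Address} (hx : Reach A S T x) (hA : x ∈ foci A) (ha : a ∈ S (some x)) :
      Reach A S T a

theorem Reach.subset {A : Set NegDesign} {S : Option Address → Set Address} {T Q : Set Address}
    (hT : T ⊆ Q) (hQ : ∀ x ∈ Q, x ∈ foci A → S (some x) ⊆ Q) {a : Address}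
    (h : Reach A S T a) : a ∈ Q := by
  induction h with
  | base h => exact hT h
  | step _ hA ha ih => exact hQ _ ih hA ha

/-- An address lies on the right of at most one base, so a path of cuts can be traced back in only
one way. Two paths ending at the same address thus start at the same element of `S none`. -/
theorem Reach.disjoint {A : Set NegDesign} {S : Option Address → Set Address}
    {T T' : Set Address} (hS : ∀ g h a, a ∈ S g → a ∈ S h → g = h) (hT : T ⊆ S none)
    (hT' : T' ⊆ S none) (hTT : ∀ a ∈ T, a ∉ T') {a : Address} (h : Reach A S T a) :
    ¬ Reach A S T' a := by
  induction h with
  | base h =>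
    rintro (h' | ⟨-, -, h'⟩)
    · exact hTT _ h h'
    · exact absurd (hS _ _ _ (hT h) h') (by simp)
  | step _ _ ha ih =>
    rintro (h' | ⟨hx, -, h'⟩)
    · exact absurd (hS _ _ _ (hT' h') ha) (by simp)
    · rw [Option.some.inj (hS _ _ _ ha h')] at ih
      exact ih hx

/-- Change the value at `none`. -/
def withRoot {α : Type} (r : α) (f : Option Address → α) : Option Address → α
  | none => r
  | some x => f (some x)

/-- Relates the nested normalization `⟦⟦φ, A none⟧, E⟧` to `⟦φ, F⟧`. The element of `E` with focus
`x` is the normal form of an element of `F` against `A (some x)`. The addresses are shared out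
between the principal design (`O none`) and the elements of `E` (`O (some x)`), each of which only
interacts with the designs in `F` that it holds in `A`. -/
structure Nested (φ : PosDesign) (A : Option Address → Set NegDesign) (E F : Set NegDesign)
    (P : Set Address) (O S : Option Address → Set Address) : Prop where
  good : GoodData φ F P S
  own_sub : ∀ g, O g ⊆ P
  own_disj : ∀ g h a, a ∈ O g → a ∈ O h → g = h
  root : S none ⊆ O none
  noPrefix : NoPrefix P (foci E ∪ ⋃ g, foci (A g))
  inner : ∀ g, ∀ ψ ∈ A g, ψ.focus ∈ O g → ψ ∈ F ∧ S (some ψ.focus) ⊆ O g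
  outer : ∀ g, ∀ ψ' ∈ E, ψ'.focus ∈ O g → ψ'.focus ∉ foci (A g) →
    ∃ ψ ∈ F, ψ.focus = ψ'.focus ∧
      (∀ J, ψ'.body J = normalForm (ψ.body J) (A (some ψ'.focus))) ∧
      S (some ψ'.focus) ⊆ O (some ψ'.focus)
  accepts : ∀ g, ∀ a ∈ O g, a ∉ foci (A g) → a ∈ foci F → a ∈ foci E

/-- Restricted to the addresses owned by the root, the inner state is itself a net, with typing and
uniqueness inherited from `F`. This makes the inner machine deterministic. -/
theorem Nested.good_inner {φ : PosDesign} {A : Option Address → Set NegDesign}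
    {E F : Set NegDesign} {P : Set Address} {O S : Option Address → Set Address}
    (h : Nested φ A E F P O S) :
    GoodData φ (A none) (O none) (fun g => S g ∩ O none) := by
  refine ⟨h.good.typed_pos.mono fun a ha => ⟨ha, h.root ha⟩, ?_, fun g => Set.inter_subset_right,
    ?_, fun g k a ha hb => h.good.disj g k a ha.1 hb.1, ?_⟩
  · intro ψ hψ hO J
    obtain ⟨h1, h2⟩ := h.inner none ψ hψ hO
    have h3 := h.good.typed_neg ψ h1 (h.own_sub _ hO) J
    exact h3.mono (Set.union_subset_union_right _ fun a ha => ⟨ha, h2 ha⟩)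
  · intro ψ hψ ψ' hψ' hO heq
    exact h.good.uniq ψ (h.inner none ψ hψ hO).1 ψ' (h.inner none ψ' hψ' (heq ▸ hO)).1
      (h.own_sub _ hO) heq
  · rintro a ha x (hx | hx)
    · exact h.good.noPrefix a (h.own_sub _ ha) x (Or.inl (h.own_sub _ hx))
    · exact h.noPrefix a (h.own_sub _ ha) x (Or.inr (Set.mem_iUnion.2 ⟨none, hx⟩))

theorem Nested.notMem_star {φ : PosDesign} {A : Option Address → Set NegDesign}
    {E F : Set NegDesign} {P : Set Address} {O S : Option Address → Set Address}
    (h : Nested φ A E F P O S) {ξ : Address} (hξ : ξ ∈ P) {J : Finset ℕ} {x : Address}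
    (hx : x ∈ Address.star ξ J) :
    x ∉ P ∧ x ∉ foci F ∧ x ∉ foci E ∧ ∀ g, x ∉ foci (A g) := by
  obtain ⟨i, -, rfl⟩ := Address.mem_star.1 hx
  have h1 := h.good.noPrefix.ext_notMem hξ i
  have h2 := h.noPrefix.ext_notMem hξ i
  simp only [Set.mem_union, Set.mem_iUnion, not_or, not_exists] at h1 h2
  exact ⟨h1.1, h1.2, h2.1, h2.2⟩

theorem NoPrefix.cut {P D D' : Set Address} {ξ : Address} {J : Finset ℕ} (h1 : NoPrefix P P)
    (h2 : NoPrefix P D) (hξ : ξ ∈ P) (hD : D' ⊆ D ∪ ↑(Address.star ξ J)) :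
    NoPrefix (P \ {ξ} ∪ ↑(Address.star ξ J)) D' := by
  have h3 : NoPrefix P (P ∪ D) := by
    rintro a ha x (hx | hx)
    · exact h1 a ha x hx
    · exact h2 a ha x hx
  refine (h3.replace Set.subset_union_left hξ J).mono subset_rfl ?_
  exact hD.trans (Set.union_subset_union_left _ Set.subset_union_right)

/-- The design cut by the inner machine also lies in `F`, so the single machine makes the same cut.
Only the root's group changes: its new addresses come from the design just cut, whose right
addresses it already owned. -/
theorem Nested.cut_inner {ξ : Address} {I : Finset ℕ}
    {c : {i // i ∈ I} → Finset ℕ → PosDesign} {A : Option Address → Set NegDesign}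
    {E F : Set NegDesign} {P : Set Address} {O S : Option Address → Set Address}
    (h : Nested (PosDesign.node ξ I c) A E F P O S) {Ti : {i // i ∈ I} → Set Address}
    (hTi : IsSplit ξ I c (S none) Ti) {ψ : NegDesign} (hψ : ψ ∈ A none) (hξ : ψ.focus = ξ) :
    Nested (ψ.body I) (withRoot (negChildren ξ I c ∪ remove (A none) ξ) A) E
      (negChildren ξ I c ∪ remove F ξ) (P \ {ξ} ∪ ↑(Address.star ξ I))
      (withRoot (O none \ {ξ} ∪ ↑(Address.star ξ I)) O) (cutRight ξ I S Ti) := by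
  have hξO : ξ ∈ O none := h.root hTi.mem
  have hξP : ξ ∈ P := h.own_sub _ hξO
  have hstar := fun x hx => h.notMem_star hξP (J := I) (x := x) hx
  obtain ⟨hψF, hψO⟩ := h.inner none ψ hψ (hξ ▸ hξO)
  rw [hξ] at hψO
  have hne : ∀ x, ∀ a ∈ S (some x), a ≠ ξ := by
    rintro x a ha rfl
    exact absurd (h.good.disj _ _ _ ha hTi.mem) (by simp)
  have hneO : ∀ x, ∀ a ∈ O (some x), a ≠ ξ := by
    rintro x a ha rfl
    exact absurd (h.own_disj _ _ _ ha hξO) (by simp)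
  have hsO : ∀ g, ∀ a ∈ O g, a ∉ Address.star ξ I :=
    fun g a ha hs => (hstar a hs).1 (h.own_sub _ ha)
  have hdisj0 : ∀ x a, a ∈ O none \ {ξ} ∪ ↑(Address.star ξ I) → a ∉ O (some x) := by
    rintro x a (ha | ha) hx
    · exact absurd (h.own_disj _ _ _ ha.1 hx) (by simp)
    · exact hsO _ _ hx ha
  refine ⟨h.good.cut hTi hψF hξ, ?_, ?_, ?_, ?_, ?_, ?_, ?_⟩
  · rintro (_ | x) a ha
    · exact ha.imp (fun h1 => ⟨h.own_sub _ h1.1, h1.2⟩) id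
    · exact Or.inl ⟨h.own_sub _ ha, hneO _ _ ha⟩
  · rintro (_ | x) (_ | y) a hx hy
    · rfl
    · exact absurd hy (hdisj0 y a hx)
    · exact absurd hx (hdisj0 x a hy)
    · exact h.own_disj _ _ a hx hy
  · rintro a (ha | ha)
    · exact Or.inr ha
    · exact Or.inl ⟨hψO ha, hne _ _ ha⟩
  · refine NoPrefix.cut (h.good.noPrefix.mono subset_rfl Set.subset_union_left) h.noPrefix hξP ?_
    rintro x (hx | hx)
    · exact Or.inl (Or.inl hx)
    · obtain ⟨_ | y, hy⟩ := Set.mem_iUnion.1 hx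
      · rcases foci_next hy with hy | hy
        · exact Or.inr hy
        · exact Or.inl (Or.inr (Set.mem_iUnion.2 ⟨none, hy.1⟩))
      · exact Or.inl (Or.inr (Set.mem_iUnion.2 ⟨some y, hy⟩))
  · rintro (_ | x) ψ' hψ' hO
    · rcases hψ' with ⟨i, rfl⟩ | ⟨h1, h2⟩
      · refine ⟨Or.inl ⟨i, rfl⟩, ?_⟩
        rw [cutRight_ext]
        exact fun a ha => Or.inl ⟨h.root (hTi.sub i ha).1, (hTi.sub i ha).2⟩
      · have h3 : ψ'.focus ∉ Address.star ξ I :=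
          fun hs => (hstar _ hs).2.2.2 none (mem_foci h1)
        obtain ⟨h4, h5⟩ := h.inner none ψ' h1 (hO.resolve_right h3).1
        refine ⟨Or.inr ⟨h4, h2⟩, ?_⟩
        rw [cutRight_of_ne h2 h3]
        exact fun a ha => Or.inl ⟨h5 ha, hne _ _ ha⟩
    · obtain ⟨h4, h5⟩ := h.inner (some x) ψ' hψ' hO
      have h2 := hneO _ _ hO
      refine ⟨Or.inr ⟨h4, h2⟩, ?_⟩
      rw [cutRight_of_ne h2 (hsO _ _ hO)]
      exact h5
  · have key : ∀ g, ∀ ψ' ∈ E, ψ'.focus ∈ O g → ψ'.focus ≠ ξ → ψ'.focus ∉ foci (A g) →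
        ∃ ψ₀ ∈ negChildren ξ I c ∪ remove F ξ, ψ₀.focus = ψ'.focus ∧
          (∀ J, ψ'.body J = normalForm (ψ₀.body J) (A (some ψ'.focus))) ∧
          cutRight ξ I S Ti (some ψ'.focus) ⊆ O (some ψ'.focus) := by
      intro g ψ' hE hO hx hA
      obtain ⟨ψ₀, h1, h2, h3, h4⟩ := h.outer g ψ' hE hO hA
      refine ⟨ψ₀, Or.inr ⟨h1, h2 ▸ hx⟩, h2, h3, ?_⟩
      rw [cutRight_of_ne hx (hsO _ _ hO)]
      exact h4
    rintro (_ | x) ψ' hE hO hA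
    -- `ξ` has left the addresses of the root, so an element of `E` with focus `ξ`, should there be
    -- one, no longer matters.
    · have h1 := hO.resolve_right fun hs => (hstar _ hs).2.2.1 (mem_foci hE)
      refine key none ψ' hE h1.1 h1.2 ?_
      rintro ⟨ψ₀, h2, h3⟩
      exact hA ⟨ψ₀, Or.inr ⟨h2, h3 ▸ h1.2⟩, h3⟩
    · exact key (some x) ψ' hE hO (hneO _ _ hO) hA
  · rintro (_ | x) a hO hA hF
    · rcases foci_next hF with h1 | h1
      · obtain ⟨i, hi, rfl⟩ := Address.mem_star.1 h1
        exact absurd ⟨_, Or.inl ⟨⟨i, hi⟩, rfl⟩, rfl⟩ hA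
      · have h2 := hO.resolve_right fun hs => (hstar _ hs).2.1 h1.1
        refine h.accepts none a h2.1 ?_ h1.1
        rintro ⟨ψ₀, h3, h4⟩
        exact hA ⟨ψ₀, Or.inr ⟨h3, h4 ▸ h1.2⟩, h4⟩
    · rcases foci_next hF with h1 | h1
      · exact absurd h1 (hsO _ _ hO)
      · exact h.accepts (some x) a hO hA h1.1

/-- An observed root changes none of the sets. The addresses of the sibling subtrees remain with the
root, which is harmless since ownership need only contain `S`. -/
theorem Nested.head {ξ : Address} {I : Finset ℕ}
    {c : {i // i ∈ I} → Finset ℕ → PosDesign} {A : Option Address → Set NegDesign}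
    {E F : Set NegDesign} {P : Set Address} {O S : Option Address → Set Address}
    (h : Nested (PosDesign.node ξ I c) A E F P O S) {Ti : {i // i ∈ I} → Set Address}
    (hTi : IsSplit ξ I c (S none) Ti) (i : {i // i ∈ I}) (J : Finset ℕ) :
    Nested (c i J) A E F (P \ {ξ} ∪ ↑(Address.star (Address.ext ξ i) J))
      (withRoot (O none \ {ξ} ∪ ↑(Address.star (Address.ext ξ i) J)) O)
      (headRight (Address.ext ξ i) J S (Ti i)) := by
  have hξO : ξ ∈ O none := h.root hTi.mem
  have hξP : ξ ∈ P := h.own_sub _ hξO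
  have hbig : NoPrefix P (P ∪ (foci F ∪ (foci E ∪ ⋃ g, foci (A g)))) := by
    rintro a ha x (hx | hx | hx)
    · exact h.good.noPrefix a ha x (Or.inl hx)
    · exact h.good.noPrefix a ha x (Or.inr hx)
    · exact h.noPrefix a ha x hx
  have hstar : ∀ x ∈ Address.star (Address.ext ξ i) J,
      x ∉ P ∪ (foci F ∪ (foci E ∪ ⋃ g, foci (A g))) := by
    intro x hx hD
    obtain ⟨j, -, rfl⟩ := Address.mem_star.1 hx
    have h1 : ξ <+: Address.ext (Address.ext ξ i) j :=
      (Address.prefix_ext ξ i).trans (Address.prefix_ext _ j)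
    have h3 := congrArg List.length (hbig ξ hξP _ hD h1)
    simp [Address.ext] at h3
  have hsA : ∀ g, ∀ x ∈ foci (A g), x ∉ Address.star (Address.ext ξ i) J :=
    fun g x hx hs => hstar x hs (Or.inr (Or.inr (Or.inr (Set.mem_iUnion.2 ⟨g, hx⟩))))
  have hsE : ∀ x ∈ foci E, x ∉ Address.star (Address.ext ξ i) J :=
    fun x hx hs => hstar x hs (Or.inr (Or.inr (Or.inl hx)))
  have hsF : ∀ x ∈ foci F, x ∉ Address.star (Address.ext ξ i) J :=
    fun x hx hs => hstar x hs (Or.inr (Or.inl hx))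
  have hsO : ∀ g, ∀ a ∈ O g, a ∉ Address.star (Address.ext ξ i) J :=
    fun g a ha hs => hstar a hs (Or.inl (h.own_sub _ ha))
  have hne : ∀ x, ∀ a ∈ S (some x), a ≠ ξ := by
    rintro x a ha rfl
    exact absurd (h.good.disj _ _ _ ha hTi.mem) (by simp)
  have hneO : ∀ x, ∀ a ∈ O (some x), a ≠ ξ := by
    rintro x a ha rfl
    exact absurd (h.own_disj _ _ _ ha hξO) (by simp)
  have hdisj0 : ∀ x a, a ∈ O none \ {ξ} ∪ ↑(Address.star (Address.ext ξ i) J) →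
      a ∉ O (some x) := by
    rintro x a (ha | ha) hx
    · exact absurd (h.own_disj _ _ _ ha.1 hx) (by simp)
    · exact hsO _ _ hx ha
  have hO' : ∀ g a, a ∈ withRoot (O none \ {ξ} ∪ ↑(Address.star (Address.ext ξ i) J)) O g →
      a ∉ Address.star (Address.ext ξ i) J → a ∈ O g := by
    rintro (_ | x) a ha hs
    · exact (ha.resolve_right hs).1
    · exact ha
  have hgood := h.good.head hTi i J
  refine ⟨hgood, ?_, ?_, ?_, ?_, ?_, ?_, ?_⟩
  · rintro (_ | x) a ha
    · exact ha.imp (fun h1 => ⟨h.own_sub _ h1.1, h1.2⟩) id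
    · exact Or.inl ⟨h.own_sub _ ha, hneO _ _ ha⟩
  · rintro (_ | x) (_ | y) a hx hy
    · rfl
    · exact absurd hy (hdisj0 y a hx)
    · exact absurd hx (hdisj0 x a hy)
    · exact h.own_disj _ _ a hx hy
  · rintro a (ha | ha)
    · exact Or.inr ha
    · exact Or.inl ⟨h.root (hTi.sub i ha).1, (hTi.sub i ha).2⟩
  · rintro a (ha | ha) x hx hax
    · exact h.noPrefix a ha.1 x hx hax
    · obtain ⟨j, -, rfl⟩ := Address.mem_star.1 ha
      have h1 : ξ <+: Address.ext (Address.ext ξ i) j :=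
        (Address.prefix_ext ξ i).trans (Address.prefix_ext _ j)
      have h2 := h.noPrefix ξ hξP x hx (h1.trans hax)
      subst h2
      have h3 := hax.length_le
      simp [Address.ext] at h3
  · rintro g ψ hψ hO
    obtain ⟨h1, h2⟩ := h.inner g ψ hψ (hO' g _ hO (hsA g _ (mem_foci hψ)))
    refine ⟨h1, fun a ha => ?_⟩
    cases g with
    | none => exact Or.inl ⟨h2 ha, hne _ _ ha⟩
    | some x => exact h2 ha
  · rintro g ψ' hE hO hA
    exact h.outer g ψ' hE (hO' g _ hO (hsE _ (mem_foci hE))) hA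
  · rintro g a hO hA hF
    exact h.accepts g a (hO' g _ hO (hsF _ hF)) hA hF

/-- The designs held by each group after a cut on `ξ` with an element of the outer set: the
principal design takes over those of the element, and its former subtrees share its own. -/
def outerHeld (ξ : Address) (I : Finset ℕ) (A : Option Address → Set NegDesign) :
    Option Address → Set NegDesign
  | none => A (some ξ)
  | some x => if x ∈ Address.star ξ I then A none else A (some x)

/-- The addresses owned by each group after a cut on `ξ` with an element of the outer set. -/
def outerOwn (ξ : Address) (I : Finset ℕ) (A : Option Address → Set NegDesign)
    (O S : Option Address → Set Address) (Ti : {i // i ∈ I} → Set Address) :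
    Option Address → Set Address
  | none => O (some ξ) ∪ ↑(Address.star ξ I)
  | some x => {a | (∃ i : {i // i ∈ I}, x = Address.ext ξ i ∧ Reach (A none) S (Ti i) a) ∨
      (x ≠ ξ ∧ x ∉ Address.star ξ I ∧ a ∈ O (some x))}

/-- The outer element cut on `ξ` is the normal form of `ψ` against `A (some ξ)`, so its body becomes
a new inner normalization with that set. The old inner set `A none` passes whole to every subtree
`i`, which owns only what is reachable from `Ti i`. -/
theorem Nested.cut_outer {ξ : Address} {I : Finset ℕ}
    {c : {i // i ∈ I} → Finset ℕ → PosDesign} {A : Option Address → Set NegDesign}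
    {E F : Set NegDesign} {P : Set Address} {O S : Option Address → Set Address}
    (h : Nested (PosDesign.node ξ I c) A E F P O S) {Ti : {i // i ∈ I} → Set Address}
    (hTi : IsSplit ξ I c (S none) Ti) {ψ : NegDesign} (hψ : ψ ∈ F) (hξ : ψ.focus = ξ)
    (hSO : S (some ξ) ⊆ O (some ξ)) :
    Nested (ψ.body I) (outerHeld ξ I A)
      (negChildren ξ I (fun i J => normalForm (c i J) (A none)) ∪ remove E ξ)
      (negChildren ξ I c ∪ remove F ξ) (P \ {ξ} ∪ ↑(Address.star ξ I))
      (outerOwn ξ I A O S Ti) (cutRight ξ I S Ti) := by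
  have hξO : ξ ∈ O none := h.root hTi.mem
  have hξP : ξ ∈ P := h.own_sub _ hξO
  have hstar := fun x hx => h.notMem_star hξP (J := I) (x := x) hx
  have hne : ∀ x, ∀ a ∈ S (some x), a ≠ ξ := by
    rintro x a ha rfl
    exact absurd (h.good.disj _ _ _ ha hTi.mem) (by simp)
  have hneO : ∀ x, ∀ a ∈ O (some x), a ≠ ξ := by
    rintro x a ha rfl
    exact absurd (h.own_disj _ _ _ ha hξO) (by simp)
  have hsO : ∀ g, ∀ a ∈ O g, a ∉ Address.star ξ I :=
    fun g a ha hs => (hstar a hs).1 (h.own_sub _ ha)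
  have hsA : ∀ g, ∀ ψ₀ ∈ A g, ψ₀.focus ∉ Address.star ξ I :=
    fun g ψ₀ hA hs => (hstar _ hs).2.2.2 g (mem_foci hA)
  have hTO : ∀ i, Ti i ⊆ O none \ {ξ} :=
    fun i a ha => ⟨h.root (hTi.sub i ha).1, (hTi.sub i ha).2⟩
  -- The old root owned the right addresses of every design it could call, so paths never leave its
  -- domain; they avoid `ξ`, which is a right address of the principal design alone.
  have hreach : ∀ i a, Reach (A none) S (Ti i) a → a ∈ O none \ {ξ} := by
    intro i a ha
    refine ha.subset (hTO i) ?_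
    rintro x ⟨hxO, -⟩ ⟨ψ₀, h1, rfl⟩ b hb
    exact ⟨(h.inner none ψ₀ h1 hxO).2 hb, hne _ _ hb⟩
  have hAext : ∀ i : {i // i ∈ I}, outerHeld ξ I A (some (Address.ext ξ i)) = A none :=
    fun i => if_pos (Address.mem_star.2 ⟨i, i.2, rfl⟩)
  have hAold : ∀ x, x ∉ Address.star ξ I → outerHeld ξ I A (some x) = A (some x) :=
    fun x hx => if_neg hx
  have hOold : ∀ x, x ≠ ξ → x ∉ Address.star ξ I →
      outerOwn ξ I A O S Ti (some x) = O (some x) := by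
    intro x h1 h2
    ext a
    constructor
    · rintro (⟨i, rfl, -⟩ | ⟨-, -, ha⟩)
      · exact absurd (Address.mem_star.2 ⟨i, i.2, rfl⟩) h2
      · exact ha
    · exact fun ha => Or.inr ⟨h1, h2, ha⟩
  have hinner : ∀ g, ∀ ψ' ∈ A g, ψ'.focus ∈ O g → ψ'.focus ≠ ξ →
      ψ' ∈ negChildren ξ I c ∪ remove F ξ ∧ cutRight ξ I S Ti (some ψ'.focus) ⊆ O g := by
    intro g ψ' hA hO hx
    obtain ⟨h1, h2⟩ := h.inner g ψ' hA hO
    refine ⟨Or.inr ⟨h1, hx⟩, ?_⟩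
    rwa [cutRight_of_ne hx (hsO _ _ hO)]
  have houter : ∀ g, ∀ ψ' ∈ E, ψ'.focus ∈ O g → ψ'.focus ≠ ξ → ψ'.focus ∉ foci (A g) →
      ∃ ψ₀ ∈ negChildren ξ I c ∪ remove F ξ, ψ₀.focus = ψ'.focus ∧
        (∀ J, ψ'.body J = normalForm (ψ₀.body J) (outerHeld ξ I A (some ψ'.focus))) ∧
        cutRight ξ I S Ti (some ψ'.focus) ⊆ outerOwn ξ I A O S Ti (some ψ'.focus) := by
    intro g ψ' hE hO hx hA
    obtain ⟨ψ₀, h1, h2, h3, h4⟩ := h.outer g ψ' hE hO hA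
    refine ⟨ψ₀, Or.inr ⟨h1, h2 ▸ hx⟩, h2, ?_, ?_⟩
    · rwa [hAold _ (hsO _ _ hO)]
    · rwa [cutRight_of_ne hx (hsO _ _ hO), hOold _ hx (hsO _ _ hO)]
  have haccepts : ∀ g, ∀ a ∈ O g, a ≠ ξ → a ∉ foci (A g) →
      a ∈ foci (negChildren ξ I c ∪ remove F ξ) →
      a ∈ foci (negChildren ξ I (fun i J => normalForm (c i J) (A none)) ∪ remove E ξ) := by
    intro g a hO hx hA hF
    have h1 := (foci_next hF).resolve_left (hsO _ _ hO)
    obtain ⟨ψ₀, h2, h3⟩ := h.accepts g a hO hA h1.1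
    exact ⟨ψ₀, Or.inr ⟨h2, h3 ▸ hx⟩, h3⟩
  refine ⟨h.good.cut hTi hψ hξ, ?_, ?_, ?_, ?_, ?_, ?_, ?_⟩
  · rintro (_ | x) a ha
    · exact ha.imp (fun h1 => ⟨h.own_sub _ h1, hneO _ _ h1⟩) id
    · rcases ha with ⟨i, -, ha⟩ | ⟨-, -, ha⟩
      · exact Or.inl ⟨h.own_sub _ (hreach i a ha).1, (hreach i a ha).2⟩
      · exact Or.inl ⟨h.own_sub _ ha, hneO _ _ ha⟩
  · have key : ∀ x a, a ∈ outerOwn ξ I A O S Ti none →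
        a ∉ outerOwn ξ I A O S Ti (some x) := by
      rintro x a (ha | ha) (⟨i, rfl, hb⟩ | ⟨h1, h2, hb⟩)
      · exact absurd (h.own_disj _ _ _ ha (hreach i a hb).1) (by simp)
      · exact h1 (Option.some.inj (h.own_disj _ _ _ hb ha))
      · exact hsO _ _ (hreach i a hb).1 ha
      · exact hsO _ _ hb ha
    rintro (_ | x) (_ | y) a hx hy
    · rfl
    · exact absurd hy (key y a hx)
    · exact absurd hx (key x a hy)
    · rcases hx with ⟨i, rfl, hx⟩ | ⟨h1, h2, hx⟩ <;> rcases hy with ⟨j, rfl, hy⟩ | ⟨h1', h2', hy⟩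
      · by_cases hij : i = j
        · rw [hij]
        · refine absurd hy (Reach.disjoint h.good.disj (fun a ha => (hTi.sub i ha).1)
            (fun a ha => (hTi.sub j ha).1) (fun a ha hb => hij (hTi.disj i j a ha hb)) hx)
      · exact absurd (h.own_disj _ _ _ hy (hreach i a hx).1) (by simp)
      · exact absurd (h.own_disj _ _ _ hx (hreach j a hy).1) (by simp)
      · exact h.own_disj _ _ a hx hy
  · rintro a (ha | ha)
    · exact Or.inr ha
    · exact Or.inl (hSO ha)
  · refine NoPrefix.cut (h.good.noPrefix.mono subset_rfl Set.subset_union_left) h.noPrefix hξP ?_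
    rintro x (hx | hx)
    · rcases foci_next hx with hx | hx
      · exact Or.inr hx
      · exact Or.inl (Or.inl hx.1)
    -- The new groups only redistribute the old held sets, so no new held focus appears.
    · refine Or.inl (Or.inr ?_)
      obtain ⟨_ | y, hy⟩ := Set.mem_iUnion.1 hx
      · exact Set.mem_iUnion.2 ⟨some ξ, hy⟩
      · by_cases hys : y ∈ Address.star ξ I
        · exact Set.mem_iUnion.2 ⟨none, by simpa [outerHeld, hys] using hy⟩
        · exact Set.mem_iUnion.2 ⟨some y, by simpa [outerHeld, hys] using hy⟩
  · rintro (_ | x) ψ' hA hO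
    · have h1 : ψ'.focus ∈ O (some ξ) := hO.resolve_right (hsA _ _ hA)
      obtain ⟨h2, h3⟩ := hinner (some ξ) ψ' hA h1 (hneO _ _ h1)
      exact ⟨h2, h3.trans Set.subset_union_left⟩
    · rcases hO with ⟨i, rfl, hO⟩ | ⟨h1, h2, hO⟩
      · rw [hAext] at hA
        obtain ⟨h3, -⟩ := hinner none ψ' hA (hreach i _ hO).1 (hreach i _ hO).2
        refine ⟨h3, fun a ha => Or.inl ⟨i, rfl, ?_⟩⟩
        rw [cutRight_of_ne (hreach i _ hO).2 (hsA _ _ hA)] at ha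
        exact Reach.step hO (mem_foci hA) ha
      · rw [hAold x h2] at hA
        rw [hOold x h1 h2]
        exact hinner (some x) ψ' hA hO (hneO _ _ hO)
  · rintro g ψ' (⟨i, rfl⟩ | ⟨hE, hx⟩) hO hA
    · refine ⟨⟨Address.ext ξ i, c i⟩, Or.inl ⟨i, rfl⟩, rfl, fun J => ?_, ?_⟩
      · rw [hAext]
      · rw [cutRight_ext]
        exact fun a ha => Or.inl ⟨i, rfl, Reach.base ha⟩
    · have hs : ψ'.focus ∉ Address.star ξ I := fun hs => (hstar _ hs).2.2.1 (mem_foci hE)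
      rcases g with _ | x
      · exact houter (some ξ) ψ' hE (hO.resolve_right hs) hx hA
      · rcases hO with ⟨i, rfl, hO⟩ | ⟨h1, h2, hO⟩
        · rw [hAext] at hA
          exact houter none ψ' hE (hreach i _ hO).1 hx hA
        · rw [hAold x h2] at hA
          exact houter (some x) ψ' hE hO hx hA
  · rintro (_ | x) a hO hA hF
    · rcases hO with hO | hO
      · exact haccepts (some ξ) a hO (hneO _ _ hO) hA hF
      · obtain ⟨i, hi, rfl⟩ := Address.mem_star.1 hO
        exact ⟨_, Or.inl ⟨⟨i, hi⟩, rfl⟩, rfl⟩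
    · rcases hO with ⟨i, rfl, hO⟩ | ⟨h1, h2, hO⟩
      · rw [hAext] at hA
        exact haccepts none a (hreach i _ hO).1 (hreach i _ hO).2 hA hF
      · rw [hAold x h2] at hA
        exact haccepts (some x) a hO (hneO _ _ hO) hA hF

/-- `⟦⟦φ, A⟧, E⟧` is a nested normalization that corresponds to `⟦φ, F⟧`. -/
def Simulates (φ : PosDesign) (A E F : Set NegDesign) : Prop :=
  ∃ B P O S, B none = A ∧ Nested φ B E F P O S

/-! ### Effect of one reduction on the simulation -/

section Simulates

variable {φ : PosDesign} {ξ : Address} {I : Finset ℕ}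
  {c : {i // i ∈ I} → Finset ℕ → PosDesign} {A E F : Set NegDesign}

theorem Simulates.det_inner (h : Simulates φ A E F) : Det (φ, A) := by
  obtain ⟨B, P, O, S, rfl, h⟩ := h
  exact Good.det ⟨_, _, h.good_inner⟩

theorem Simulates.det (h : Simulates φ A E F) : Det (φ, F) := by
  obtain ⟨B, P, O, S, -, h⟩ := h
  exact Good.det ⟨_, _, h.good⟩

theorem Simulates.inner (h : Simulates (PosDesign.node ξ I c) A E F) {ψ : NegDesign}
    (hψ : ψ ∈ A) (hξ : ψ.focus = ξ) :
    ψ ∈ F ∧ Simulates (ψ.body I) (negChildren ξ I c ∪ remove A ξ) E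
      (negChildren ξ I c ∪ remove F ξ) := by
  obtain ⟨B, P, O, S, rfl, h⟩ := h
  obtain ⟨Ti, hTi⟩ := h.good.typed_pos.exists_isSplit
  exact ⟨(h.inner none ψ hψ (hξ ▸ h.root hTi.mem)).1, _, _, _, _, rfl, h.cut_inner hTi hψ hξ⟩

theorem Simulates.outer (h : Simulates (PosDesign.node ξ I c) A E F) (hA : ¬ Accepts A ξ)
    {ψ' : NegDesign} (hψ' : ψ' ∈ E) (hξ : ψ'.focus = ξ) :
    ∃ ψ ∈ F, ψ.focus = ξ ∧ ∃ A', ψ'.body I = normalForm (ψ.body I) A' ∧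
      Simulates (ψ.body I) A'
        (negChildren ξ I (fun i J => normalForm (c i J) A) ∪ remove E ξ)
        (negChildren ξ I c ∪ remove F ξ) := by
  obtain ⟨B, P, O, S, rfl, h⟩ := h
  obtain ⟨Ti, hTi⟩ := h.good.typed_pos.exists_isSplit
  subst hξ
  obtain ⟨ψ, h1, h2, h3, h4⟩ := h.outer none ψ' hψ' (h.root hTi.mem) hA
  exact ⟨ψ, h1, h2, _, h3 I, _, _, _, _, rfl, h.cut_outer hTi h1 h2 h4⟩

theorem Simulates.accepts (h : Simulates (PosDesign.node ξ I c) A E F) (hA : ¬ Accepts A ξ)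
    (hF : Accepts F ξ) : Accepts E ξ := by
  obtain ⟨B, P, O, S, rfl, h⟩ := h
  obtain ⟨Ti, hTi⟩ := h.good.typed_pos.exists_isSplit
  exact h.accepts none ξ (h.root hTi.mem) hA hF

theorem Simulates.head (h : Simulates (PosDesign.node ξ I c) A E F) (i : {i // i ∈ I})
    (J : Finset ℕ) : Simulates (c i J) A E F := by
  obtain ⟨B, P, O, S, rfl, h⟩ := h
  obtain ⟨Ti, hTi⟩ := h.good.typed_pos.exists_isSplit
  exact ⟨_, _, _, _, rfl, h.head hTi i J⟩

theorem Simulates.normalForm_inner (h : Simulates (PosDesign.node ξ I c) A E F)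
    {ψ : NegDesign} (hψ : ψ ∈ A) (hξ : ψ.focus = ξ) :
    normalForm (PosDesign.node ξ I c) A =
      normalForm (ψ.body I) (negChildren ξ I c ∪ remove A ξ) :=
  normalForm_step h.det_inner (Step.cut hψ hξ)

end Simulates

/-! ### Transfer of termination and outputs -/

/-- If the single normalization has an output then so has the nested one. -/
theorem Simulates.exists_outputs {s : State} {o : designFunctor.Obj State} (ho : Outputs s o) :
    ∀ {A E : Set NegDesign}, Simulates s.1 A E s.2 →
      (∃ o', Outputs (s.1, A) o') ∧ ∃ o', Outputs (normalForm s.1 A, E) o' := by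
  obtain ⟨t, hst, ht⟩ := ho
  induction hst using ReflTransGen.head_induction_on with
  | refl =>
    intro A E h
    cases ht with
    | omega =>
      refine ⟨⟨_, Outputs.of_final Final.omega⟩, ?_⟩
      rw [normalForm_omega]
      exact ⟨_, Outputs.of_final Final.omega⟩
    | daimon =>
      refine ⟨⟨_, Outputs.of_final Final.daimon⟩, ?_⟩
      rw [normalForm_daimon]
      exact ⟨_, Outputs.of_final Final.daimon⟩
    | @head ξ I c F hF =>
      -- An element of `A` or `E` with focus `ξ` would yield one in `F`, which refuses `ξ`.
      have hA : ¬ Accepts A ξ := fun ⟨ψ, h1, h2⟩ => hF ⟨ψ, (h.inner h1 h2).1, h2⟩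
      have hE : ¬ Accepts E ξ := by
        rintro ⟨ψ, h1, h2⟩
        obtain ⟨ψ', h3, h4, -⟩ := h.outer hA h1 h2
        exact hF ⟨ψ', h3, h4⟩
      refine ⟨⟨_, Outputs.of_final (Final.head hA)⟩, ?_⟩
      dsimp only
      rw [normalForm_head hA]
      exact ⟨_, Outputs.of_final (Final.head hE)⟩
  | @head s s' hs _ ih =>
    intro A E h
    have hdet : Det s := h.det
    have hs0 := hs
    cases hs with
    | @cut ξ I c F ψ hψ hξ =>
      dsimp only at h ⊢
      by_cases hA : Accepts A ξ
      · obtain ⟨ψ', h1, h2⟩ := hA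
        obtain ⟨h3, h4⟩ := h.inner h1 h2
        -- By determinism the given step of the single machine is the cut with `ψ'`, so the
        -- induction hypothesis speaks of the state obtained from the inner cut.
        obtain h5 := hdet _ ReflTransGen.refl _ _ hs0 (Step.cut h3 h2)
        have h6 := ih (A := negChildren ξ I c ∪ remove A ξ) (E := E)
        rw [h5] at h6
        obtain ⟨⟨o₁, h7⟩, h8⟩ := h6 h4
        rw [h.normalForm_inner h1 h2]
        exact ⟨⟨o₁, Outputs.of_step (Step.cut h1 h2) h7⟩, h8⟩
      · refine ⟨⟨_, Outputs.of_final (Final.head hA)⟩, ?_⟩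
        rw [normalForm_head hA]
        obtain ⟨ψ', h1, h2⟩ := h.accepts hA ⟨ψ, hψ, hξ⟩
        obtain ⟨ψ₀, h3, h4, A', h5, h6⟩ := h.outer hA h1 h2
        obtain h7 := hdet _ ReflTransGen.refl _ _ hs0 (Step.cut h3 h4)
        have h8 := ih (A := A')
          (E := negChildren ξ I (fun i J => normalForm (c i J) A) ∪ remove E ξ)
        rw [h7] at h8
        obtain ⟨-, o₂, h9⟩ := h8 h6
        refine ⟨o₂, Outputs.of_step (Step.cut h1 h2) ?_⟩
        rw [h5]
        exact h9

/-- The outputs of a nested normalization and of the single one have the same label, and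
correspond to each other above it. -/
inductive Matches : designFunctor.Obj State → designFunctor.Obj State → Prop
  | omega : Matches (omegaLayer State) (omegaLayer State)
  | daimon : Matches (daimonLayer State) (daimonLayer State)
  | head {ξ : Address} {I : Finset ℕ} {c : {i // i ∈ I} → Finset ℕ → PosDesign}
      {A E F : Set NegDesign} (h : ∀ i J, Simulates (c i J) A E F) :
      Matches (nodeLayer ξ I fun i J => (normalForm (c i J) A, E))
        (nodeLayer ξ I fun i J => (c i J, F))

/-- `o` is matched by the output of `s`, or it is `Ω` and `s` has no output. -/
def Matched (o : designFunctor.Obj State) (s : State) : Prop :=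
  (∃ o', Outputs s o' ∧ Matches o o') ∨ (o = omegaLayer State ∧ ¬ ∃ o', Outputs s o')

theorem Matched.of_step {o : designFunctor.Obj State} {s t : State} (hd : Det s)
    (hst : Step s t) (h : Matched o t) : Matched o s := by
  rcases h with ⟨o', h1, h2⟩ | ⟨h1, h2⟩
  · exact Or.inl ⟨o', Outputs.of_step hst h1, h2⟩
  · exact Or.inr ⟨h1, fun ⟨o', ho'⟩ => h2 ⟨o', hd.outputs_step hst ho'⟩⟩

/-- Follows the inner normalization, when it has an output, up to the next outer step. -/
theorem Simulates.matched_of_inner {o oi : designFunctor.Obj State} {l si : State}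
    (hl : Final l o ∨ ∃ l', Step l l' ∧ ∀ φ A E F, Simulates φ A E F →
      l' = (normalForm φ A, E) → Matched o (φ, F))
    (hsi : Outputs si oi) :
    ∀ {E F : Set NegDesign}, Simulates si.1 si.2 E F → l = (normalForm si.1 si.2, E) →
      Matched o (si.1, F) := by
  obtain ⟨t, hst, ht⟩ := hsi
  -- The outer state `l` stays fixed, since inner cuts change neither `⟦φ, A⟧` nor `E`. When the
  -- inner run stops, `hl` either ends the outer run or supplies its induction hypothesis.
  induction hst using ReflTransGen.head_induction_on with
  | refl =>
    intro E F h hle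
    cases ht with
    | omega =>
      rw [normalForm_omega] at hle
      subst hle
      rcases hl with hl | ⟨l', hl, -⟩
      · rw [hl.omega_inv]
        exact Or.inl ⟨_, Outputs.of_final Final.omega, Matches.omega⟩
      · exact absurd hl not_step_omega
    | daimon =>
      rw [normalForm_daimon] at hle
      subst hle
      rcases hl with hl | ⟨l', hl, -⟩
      · rw [hl.daimon_inv]
        exact Or.inl ⟨_, Outputs.of_final Final.daimon, Matches.daimon⟩
      · exact absurd hl not_step_daimon
    | @head ξ I c A hA =>
      dsimp only at h hle ⊢
      rw [normalForm_head hA] at hle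
      subst hle
      rcases hl with hl | ⟨l', hl, ih⟩
      · obtain ⟨hE, rfl⟩ := hl.node_inv
        have hF : ¬ Accepts F ξ := fun hF => hE (h.accepts hA hF)
        exact Or.inl ⟨_, Outputs.of_final (Final.head hF), Matches.head h.head⟩
      · obtain ⟨ψ', h1, h2, rfl⟩ := hl.node_inv
        obtain ⟨ψ, h3, h4, A', h5, h6⟩ := h.outer hA h1 h2
        exact (ih _ _ _ _ h6 (by rw [h5])).of_step h.det (Step.cut h3 h4)
  | @head s s' hs _ ih =>
    intro E F h hle
    cases hs with
    | @cut ξ I c A ψ hψ hξ =>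
      dsimp only at h hle ⊢
      rw [h.normalForm_inner hψ hξ] at hle
      obtain ⟨h1, h2⟩ := h.inner hψ hξ
      exact (ih h2 hle).of_step h.det (Step.cut h1 hξ)

/-- The case added here is a diverging inner machine: `⟦φ, A⟧` is then `Ω`, on which the outer
machine stops, and the single machine must diverge too, since its output would force an inner one.
-/
theorem Simulates.matched_step {o : designFunctor.Obj State} {l : State}
    (hl : Final l o ∨ ∃ l', Step l l' ∧ ∀ φ A E F, Simulates φ A E F →
      l' = (normalForm φ A, E) → Matched o (φ, F))
    {φ : PosDesign} {A E F : Set NegDesign} (h : Simulates φ A E F)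
    (hle : l = (normalForm φ A, E)) : Matched o (φ, F) := by
  by_cases hi : ∃ oi, Outputs (φ, A) oi
  · obtain ⟨oi, hoi⟩ := hi
    exact Simulates.matched_of_inner hl hoi h hle
  · rw [normalForm_of_not_outputs hi] at hle
    subst hle
    rcases hl with hl | ⟨l', hl, -⟩
    · refine Or.inr ⟨hl.omega_inv, ?_⟩
      rintro ⟨o', ho'⟩
      exact hi (Simulates.exists_outputs ho' h).1
    · exact absurd hl not_step_omega

/-- A lexicographic induction: on the outer run here, and between two outer steps on the inner run.
-/
theorem Simulates.matched {o : designFunctor.Obj State} {l : State} (ho : Outputs l o) :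
    ∀ φ A E F, Simulates φ A E F → l = (normalForm φ A, E) → Matched o (φ, F) := by
  obtain ⟨t, hlt, ht⟩ := ho
  induction hlt using ReflTransGen.head_induction_on with
  | refl => exact fun φ A E F h hle => h.matched_step (Or.inl ht) hle
  | head hs _ ih => exact fun φ A E F h hle => h.matched_step (Or.inr ⟨_, hs, ih⟩) hle

theorem Simulates.matches_observe {φ : PosDesign} {A E F : Set NegDesign}
    (h : Simulates φ A E F) : Matches (observe (normalForm φ A, E)) (observe (φ, F)) := by
  by_cases hl : ∃ o, Outputs (normalForm φ A, E) o
  · obtain ⟨o, ho⟩ := hl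
    rcases Simulates.matched (observe_spec ho) _ _ _ _ h rfl with ⟨o', h1, h2⟩ | ⟨h1, h2⟩
    · rwa [h.det.observe_eq h1]
    · rw [h1, observe_of_not h2]
      exact Matches.omega
  · rw [observe_of_not hl, observe_of_not fun ⟨o, ho⟩ => hl (Simulates.exists_outputs ho h).2]
    exact Matches.omega

/-- Being two normal forms linked by `Simulates` is a bisimulation: matching observations have equal
labels, and the states above them are again linked. -/
theorem Simulates.normalForm_eq {φ : PosDesign} {A E F : Set NegDesign}
    (h : Simulates φ A E F) : normalForm (normalForm φ A) E = normalForm φ F := by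
  refine PFunctor.M.bisim (fun x y => ∃ φ A E F, Simulates φ A E F ∧
    x = normalForm (normalForm φ A) E ∧ y = normalForm φ F) ?_ _ _ ⟨φ, A, E, F, h, rfl, rfl⟩
  rintro _ _ ⟨φ, A, E, F, h, rfl, rfl⟩
  rw [dest_normalForm, dest_normalForm]
  have hm := h.matches_observe
  generalize observe (normalForm φ A, E) = o at hm
  generalize observe (φ, F) = o' at hm
  cases hm with
  | omega => exact ⟨_, _, _, rfl, rfl, fun e => e.elim⟩
  | daimon => exact ⟨_, _, _, rfl, rfl, fun e => e.elim⟩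
  | head h' => exact ⟨_, _, _, rfl, rfl, fun p => ⟨_, _, _, _, h' p.1 p.2, rfl, rfl⟩⟩

/-! ### Nets -/

/-- The right addresses of the elements of a net, by vertex. -/
def netRight (Λ₀ : Finset Address) (Ψ : Set NegDesign) (Λ : NegDesign → Finset Address) :
    Option Address → Set Address
  | none => Λ₀
  | some x => {a | ∃ ψ ∈ Ψ, ψ.focus = x ∧ a ∈ Λ ψ}

section Net

variable {φ : PosDesign} {Ψ Ψ₁ Ψ₂ : Set NegDesign} {Λ₀ : Finset Address}
  {Λ : NegDesign → Finset Address}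

theorem mem_vertices_none : none ∈ vertices Ψ := Set.mem_insert _ _

theorem mem_vertices_some {ψ : NegDesign} (h : ψ ∈ Ψ) : some ψ ∈ vertices Ψ :=
  Set.mem_insert_of_mem _ (Set.mem_image_of_mem _ h)

theorem IsNet.eq_of_focus_eq (h : IsNet φ Λ₀ Ψ Λ) {ψ ψ' : NegDesign} (hψ : ψ ∈ Ψ)
    (hψ' : ψ' ∈ Ψ) (heq : ψ'.focus = ψ.focus) : ψ' = ψ :=
  Option.some.inj (h.left_unique _ (mem_vertices_some hψ') _ (mem_vertices_some hψ) ψ'.focus rfl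
    heq)

theorem IsNet.netRight_disj (h : IsNet φ Λ₀ Ψ Λ) (u v : Option Address) (a : Address)
    (hu : a ∈ netRight Λ₀ Ψ Λ u) (hv : a ∈ netRight Λ₀ Ψ Λ v) : u = v := by
  rcases u with _ | x <;> rcases v with _ | y
  · rfl
  · obtain ⟨ψ, h1, -, h2⟩ := hv
    exact absurd (h.right_unique _ mem_vertices_none _ (mem_vertices_some h1) a hu h2) (by simp)
  · obtain ⟨ψ, h1, -, h2⟩ := hu
    exact absurd (h.right_unique _ mem_vertices_none _ (mem_vertices_some h1) a hv h2) (by simp)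
  · obtain ⟨ψ, h1, rfl, h2⟩ := hu
    obtain ⟨ψ', h1', rfl, h2'⟩ := hv
    rw [Option.some.inj
      (h.right_unique _ (mem_vertices_some h1) _ (mem_vertices_some h1') a h2 h2')]

theorem IsNet.noPrefix (h : IsNet φ Λ₀ Ψ Λ) :
    NoPrefix (⋃ g, netRight Λ₀ Ψ Λ g) ((⋃ g, netRight Λ₀ Ψ Λ g) ∪ foci Ψ) := by
  have key : ∀ a ∈ ⋃ g, netRight Λ₀ Ψ Λ g, ∃ u ∈ vertices Ψ, a ∈ leftOf u ∪ rightOf Λ₀ Λ u := by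
    intro a ha
    obtain ⟨_ | x, hx⟩ := Set.mem_iUnion.1 ha
    · exact ⟨_, mem_vertices_none, Or.inr hx⟩
    · obtain ⟨ψ, h1, -, h2⟩ := hx
      exact ⟨_, mem_vertices_some h1, Or.inr h2⟩
  intro a ha x hx hax
  obtain ⟨u, hu, hau⟩ := key a ha
  obtain ⟨v, hv, hxv⟩ : ∃ v ∈ vertices Ψ, x ∈ leftOf v ∪ rightOf Λ₀ Λ v := by
    rcases hx with hx | ⟨ψ, h1, rfl⟩
    · exact key x hx
    · exact ⟨_, mem_vertices_some h1, Or.inl rfl⟩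
  exact (h.disj_or_eq u hu v hv a hau x hxv).resolve_right fun hd => hd.1 hax

theorem IsNet.netRight_eq (h : IsNet φ Λ₀ Ψ Λ) {ψ : NegDesign} (hψ : ψ ∈ Ψ) :
    netRight Λ₀ Ψ Λ (some ψ.focus) = ↑(Λ ψ) := by
  ext a
  constructor
  · rintro ⟨ψ', h1, h2, h3⟩
    rwa [h.eq_of_focus_eq hψ h1 h2] at h3
  · exact fun ha => ⟨ψ, hψ, rfl, ha⟩

theorem IsNet.goodData (h : IsNet φ Λ₀ Ψ Λ) :
    GoodData φ Ψ (⋃ g, netRight Λ₀ Ψ Λ g) (netRight Λ₀ Ψ Λ) := by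
  refine ⟨⟨Λ₀, subset_rfl, h.typed_pos⟩, ?_, fun g => Set.subset_iUnion _ g, ?_,
    h.netRight_disj, h.noPrefix⟩
  · intro ψ hψ _
    rw [h.netRight_eq hψ]
    exact (h.typed_neg ψ hψ).negOK
  · exact fun ψ hψ ψ' hψ' _ heq => h.eq_of_focus_eq hψ hψ' heq

/-- The root holds `Ψ₁` and owns all it can reach from `Λ₀` through it. Every other design holds
nothing and owns its right addresses, except that those with a focus in `foci Ψ₁` own nothing, being
reserved for the root. -/
theorem IsNet.simulates (h : IsNet φ Λ₀ (Ψ₁ ∪ Ψ₂) Λ)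
    (hsep : ∀ ψ₁ ∈ Ψ₁, ∀ ψ₂ ∈ Ψ₂ \ Ψ₁, ψ₁.focus ∉ Λ ψ₂) :
    Simulates φ Ψ₁ Ψ₂ (Ψ₁ ∪ Ψ₂) := by
  let S := netRight Λ₀ (Ψ₁ ∪ Ψ₂) Λ
  let O : Option Address → Set Address := fun
    | none => {a | Reach Ψ₁ S Λ₀ a}
    | some x => {a | x ∉ foci Ψ₁ ∧ a ∈ S (some x)}
  let B : Option Address → Set NegDesign := fun
    | none => Ψ₁
    | some _ => ∅
  have hreach : ∀ a, Reach Ψ₁ S Λ₀ a → a ∈ S none ∨ ∃ y ∈ foci Ψ₁, a ∈ S (some y) := by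
    rintro a (ha | ⟨-, hx, ha⟩)
    · exact Or.inl ha
    · exact Or.inr ⟨_, hx, ha⟩
  have hdisj0 : ∀ x a, a ∈ O none → a ∉ O (some x) := by
    rintro x a ha ⟨hx, hax⟩
    rcases hreach a ha with h1 | ⟨y, h1, h2⟩
    · exact absurd (h.netRight_disj _ _ _ h1 hax) (by simp)
    · rw [Option.some.inj (h.netRight_disj _ _ _ h2 hax)] at h1
      exact hx h1
  -- The place of the separation hypothesis: a design outside `Ψ₁` never calls one in `Ψ₁`, so
  -- whatever a group cannot serve from its own set must be served by `Ψ₂`.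
  have hO : ∀ g, ∀ a ∈ O g, a ∉ foci (B g) → a ∉ foci Ψ₁ := by
    rintro (_ | x) a ha hB hA
    · exact hB hA
    · obtain ⟨hx, ψ, h1, rfl, h2⟩ := ha
      have h3 : ψ ∉ Ψ₁ := fun h3 => hx (mem_foci h3)
      obtain ⟨ψ₁, h4, rfl⟩ := hA
      exact hsep ψ₁ h4 ψ ⟨h1.resolve_left h3, h3⟩ h2
  refine ⟨B, _, O, S, rfl, h.goodData, ?_, ?_, fun a ha => Reach.base ha, ?_, ?_, ?_, ?_⟩
  · rintro (_ | x) a ha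
    · rcases hreach a ha with h1 | ⟨y, -, h1⟩
      · exact Set.mem_iUnion.2 ⟨_, h1⟩
      · exact Set.mem_iUnion.2 ⟨_, h1⟩
    · exact Set.mem_iUnion.2 ⟨_, ha.2⟩
  · rintro (_ | x) (_ | y) a hx hy
    · rfl
    · exact absurd hy (hdisj0 y a hx)
    · exact absurd hx (hdisj0 x a hy)
    · exact h.netRight_disj _ _ a hx.2 hy.2
  · refine h.noPrefix.mono subset_rfl ?_
    rintro x (⟨ψ, h1, rfl⟩ | hx)
    · exact Or.inr (mem_foci (Or.inr h1))
    · obtain ⟨_ | y, ψ, h1, rfl⟩ := Set.mem_iUnion.1 hx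
      · exact Or.inr (mem_foci (Or.inl h1))
      · exact h1.elim
  · rintro (_ | x) ψ hψ hψO
    · exact ⟨Or.inl hψ, fun a ha => Reach.step hψO (mem_foci hψ) ha⟩
    · exact hψ.elim
  · intro g ψ hψ hψO hB
    exact ⟨ψ, Or.inr hψ, rfl, fun J => (normalForm_empty _).symm,
      fun a ha => ⟨hO g _ hψO hB, ha⟩⟩
  · rintro g a ha hB ⟨ψ, h1, rfl⟩
    exact mem_foci (h1.resolve_left fun h2 => hO g _ ha hB (mem_foci h2))

end Net

end Ludics

end

theorem mainTheorem7 (φ : Ludics.PosDesign) (Ψ₁ Ψ₂ : Set Ludics.NegDesign)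
    (Λ₀ : Finset Ludics.Address) (Λ : Ludics.NegDesign → Finset Ludics.Address)
    (hnet : Ludics.IsNet φ Λ₀ (Ψ₁ ∪ Ψ₂) Λ)
    (hsep : ∀ ψ₁ ∈ Ψ₁, ∀ ψ₂ ∈ Ψ₂ \ Ψ₁, ψ₁.focus ∉ Λ ψ₂) :
    Ludics.normalForm (Ludics.normalForm φ Ψ₁) Ψ₂ = Ludics.normalForm φ (Ψ₁ ∪ Ψ₂) :=
  (hnet.simulates hsep).normalForm_eq
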